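/- All graphs are finite and simple. A graph is planar if it is $\{K_5,K_{3,3}\}$-minor free. For a graph $G$ on $n\ge 2$ vertices let $\lambda_1(G)\ge\lambda_2(G)\ge\dots\ge\lambda_n(G)$ be the eigenvalues of its adjacency matrix, counted with multiplicity. For $s\ge 3$ let $F_s$ be the graph obtained from $K_{2,s}$, with colour classes $\{v_1,v_2\}$ and $\{u_1,\dots,u_s\}$, by subdividing each of the edges $v_1u_1$ and $v_1u_2$ once and attaching one pendant edge to each of $u_3,\dots,u_s$. Let $\mathcal F_1=\{F_s : s\ge 3\}$. Let $H_1,\dots,H_{13}$ be the following graphs, where $ij$ denotes the edge $\{i,j\}$: - $H_{1}$, on $\{0,\dots,7\}$: $01,\ 12,\ 23,\ 34,\ 40,\ 05,\ 16,\ 37,\ 57,\ 67$; - $H_{2}$, on $\{0,\dots,9\}$: $01,\ 12,\ 23,\ 30,\ 14,\ 34,\ 15,\ 35,\ 06,\ 07,\ 46,\ 57,\ 18,\ 39$; - $H_{3}$, on $\{0,\dots,8\}$: $01,\ 12,\ 23,\ 30,\ 04,\ 05,\ 06,\ 27,\ 28,\ 47,\ 57,\ 58,\ 68$; - $H_{4}$,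 on $\{0,\dots,8\}$: $01,\ 12,\ 23,\ 30,\ 04,\ 05,\ 06,\ 17,\ 28,\ 47,\ 48,\ 58$; - $H_{5}$, on $\{0,\dots,9\}$: $01,\ 12,\ 23,\ 30,\ 04,\ 05,\ 06,\ 17,\ 18,\ 19,\ 47,\ 58,\ 69$; - $H_{6}$, on $\{0,\dots,8\}$: $01,\ 12,\ 23,\ 30,\ 04,\ 05,\ 06,\ 17,\ 38,\ 47,\ 48$; - $H_{7}$, on $\{0,\dots,8\}$: $01,\ 12,\ 23,\ 30,\ 04,\ 05,\ 16,\ 27,\ 28,\ 47,\ 57,\ 58,\ 56$; - $H_{8}$, on $\{0,\dots,8\}$: $01,\ 12,\ 23,\ 30,\ 04,\ 05,\ 16,\ 27,\ 38,\ 46,\ 47,\ 48$; - $H_{9}$, on $\{0,\dots,8\}$: $01,\ 12,\ 23,\ 30,\ 04,\ 05,\ 16,\ 17,\ 28,\ 46,\ 48$; - $H_{10}$, on $\{0,\dots,7\}$: $01,\ 12,\ 23,\ 30,\ 04,\ 15,\ 26,\ 37,\ 45,\ 56,\ 67,\ 74$; - $H_{11}$, on $\{0,\dots,9\}$: $01,\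 12,\ 23,\ 30,\ 14,\ 34,\ 05,\ 25,\ 06,\ 07,\ 18,\ 39,\ 46$; - $H_{12}$, on $\{0,\dots,9\}$: $01,\ 12,\ 23,\ 30,\ 14,\ 34,\ 05,\ 25,\ 06,\ 17,\ 28,\ 39,\ 46,\ 48$; - $H_{13}$, on $\{0,\dots,9\}$: $01,\ 12,\ 23,\ 30,\ 14,\ 34,\ 05,\ 25,\ 06,\ 17,\ 28,\ 39$. **Theorem 3.1.** Let $G$ be a connected triangle-free planar graph with at least two vertices. Then $\lambda_2(G)\le 1$ if and only if $G$ is isomorphic to an induced subgraph of a graph belonging to $\mathcal F_1\cup\{H_1,H_2,\dots,H_{13}\}$. -/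

import Mathlib

namespace TriangleFreePlanar

/-- `H` is a minor of `G`: there are pairwise disjoint vertex sets of `G`, one for each vertex
of `H`, each inducing a (nonempty) connected subgraph, such that adjacent vertices of `H` have
sets joined by an edge of `G`. -/
def IsMinor {W V : Type*} (H : SimpleGraph W) (G : SimpleGraph V) : Prop :=
  ∃ B : W → Set V,
    (∀ x, (G.induce (B x)).Connected) ∧
    (∀ x y, x ≠ y → Disjoint (B x) (B y)) ∧
    (∀ x y, H.Adj x y → ∃ a ∈ B x, ∃ b ∈ B y, G.Adj a b)

/-- Planarity of a finite graph, as freeness from the minors `K₅` and `K₃,₃`. -/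
def IsPlanar {V : Type*} (G : SimpleGraph V) : Prop :=
  ¬ IsMinor (⊤ : SimpleGraph (Fin 5)) G ∧
    ¬ IsMinor (completeBipartiteGraph (Fin 3) (Fin 3)) G

/-- The second largest eigenvalue, with multiplicity, of the adjacency matrix of a graph on
at least two vertices. The list `eigenvalues₀` is in nonincreasing order, with index from `0`. -/
noncomputable def lambda2 {V : Type*} [Fintype V] [DecidableEq V] (G : SimpleGraph V)
    [DecidableRel G.Adj] (hV : 1 < Fintype.card V) : ℝ :=
  (G.isHermitian_adjMatrix ℝ).eigenvalues₀ ⟨1, hV⟩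

/-- The vertices of the graph `F1 s`. The vertices `v1`, `v2` and `u i` are those of `K₂,ₛ`.
For the first two indices `i` the vertex `w i` is the one that subdivides the edge `v1 u i`; for
the other indices it is the end of the pendant edge attached to `u i`. -/
inductive F1Vertex (s : ℕ) : Type
  | v1 : F1Vertex s
  | v2 : F1Vertex s
  | u (i : Fin s) : F1Vertex s
  | w (i : Fin s) : F1Vertex s

/-- The edges of `F1 s`, each in one direction. -/
def F1Edge (s : ℕ) : F1Vertex s → F1Vertex s → Prop
  | .v2, .u _ => True
  | .v1, .u i => 2 ≤ i.val
  | .v1, .w i => i.val < 2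
  | .u i, .w j => i = j
  | _, _ => False

/-- The graph obtained from `K₂,ₛ`, with classes `{v1, v2}` and `{u i}`, by subdividing the
edges from `v1` to the first two `u i` and attaching a pendant edge to every other `u i`. -/
def F1 (s : ℕ) : SimpleGraph (F1Vertex s) :=
  SimpleGraph.fromRel (F1Edge s)

/-- The graph on `{0, …, n - 1}` with a given list of edges. -/
def ofEdges (n : ℕ) (l : List (Fin n × Fin n)) : SimpleGraph (Fin n) :=
  SimpleGraph.fromRel (fun a b => (a, b) ∈ l)

def H1 : SimpleGraph (Fin 8) :=
  ofEdges 8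
   [(0, 1), (1, 2), (2, 3), (3, 4), (4, 0), (0, 5), (1, 6), (3, 7), (5, 7), (6, 7)]

def H2 : SimpleGraph (Fin 10) :=
  ofEdges 10
   [(0, 1), (1, 2), (2, 3), (3, 0), (1, 4), (3, 4), (1, 5), (3, 5), (0, 6), (0, 7), (4, 6),
    (5, 7), (1, 8), (3, 9)]

def H3 : SimpleGraph (Fin 9) :=
  ofEdges 9
   [(0, 1), (1, 2), (2, 3), (3, 0), (0, 4), (0, 5), (0, 6), (2, 7), (2, 8), (4, 7), (5, 7),
    (5, 8), (6, 8)]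

def H4 : SimpleGraph (Fin 9) :=
  ofEdges 9
   [(0, 1), (1, 2), (2, 3), (3, 0), (0, 4), (0, 5), (0, 6), (1, 7), (2, 8), (4, 7), (4, 8),
    (5, 8)]

def H5 : SimpleGraph (Fin 10) :=
  ofEdges 10
   [(0, 1), (1, 2), (2, 3), (3, 0), (0, 4), (0, 5), (0, 6), (1, 7), (1, 8), (1, 9), (4, 7),
    (5, 8), (6, 9)]

def H6 : SimpleGraph (Fin 9) :=
  ofEdges 9
   [(0, 1), (1, 2), (2, 3), (3, 0), (0, 4), (0, 5), (0, 6), (1, 7), (3, 8), (4, 7), (4, 8)]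

def H7 : SimpleGraph (Fin 9) :=
  ofEdges 9
   [(0, 1), (1, 2), (2, 3), (3, 0), (0, 4), (0, 5), (1, 6), (2, 7), (2, 8), (4, 7), (5, 7),
    (5, 8), (5, 6)]

def H8 : SimpleGraph (Fin 9) :=
  ofEdges 9
   [(0, 1), (1, 2), (2, 3), (3, 0), (0, 4), (0, 5), (1, 6), (2, 7), (3, 8), (4, 6), (4, 7),
    (4, 8)]

def H9 : SimpleGraph (Fin 9) :=
  ofEdges 9
   [(0, 1), (1, 2), (2, 3), (3, 0), (0, 4), (0, 5), (1, 6), (1, 7), (2, 8), (4, 6), (4, 8)]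

def H10 : SimpleGraph (Fin 8) :=
  ofEdges 8
   [(0, 1), (1, 2), (2, 3), (3, 0), (0, 4), (1, 5), (2, 6), (3, 7), (4, 5), (5, 6), (6, 7),
    (7, 4)]

def H11 : SimpleGraph (Fin 10) :=
  ofEdges 10
   [(0, 1), (1, 2), (2, 3), (3, 0), (1, 4), (3, 4), (0, 5), (2, 5), (0, 6), (0, 7), (1, 8),
    (3, 9), (4, 6)]

def H12 : SimpleGraph (Fin 10) :=
  ofEdges 10
   [(0, 1), (1, 2), (2, 3), (3, 0), (1, 4), (3, 4), (0, 5), (2, 5), (0, 6), (1, 7), (2, 8),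
    (3, 9), (4, 6), (4, 8)]

def H13 : SimpleGraph (Fin 10) :=
  ofEdges 10
   [(0, 1), (1, 2), (2, 3), (3, 0), (1, 4), (3, 4), (0, 5), (2, 5), (0, 6), (1, 7), (2, 8),
    (3, 9)]

end TriangleFreePlanar

/-!
The condition `λ₂ ≤ 1` says that the quadratic form of `1 - A` is nonnegative on a hyperplane, so
that it obeys a reverse Cauchy–Schwarz inequality. Apply this to a positive combination of the
vertices of a star on which the form is negative: after projection along it, the form is positive
semidefinite on the vertices outside the star, and each pair of them has a Gram matrix entry that
only depends on their adjacency and on the numbers of leaves to which they are adjacent.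

Let the centre of the star have maximum degree. If the degree is at most five, an exhaustive search
adds the outer vertices one by one, keeps the cases in which the principal minors of order two and
three are nonnegative, and ends in induced subgraphs of the listed graphs. If the degree is at least
six, the minors show that an outer vertex is adjacent to no leaf, to one leaf, or to all but at most
two. Planarity makes the vertex of the last kind unique, and this is the structure of `F1`.

Conversely, the listed graphs satisfy the condition by explicit sums of squares, and the condition
passes to induced subgraphs.
-/

namespace TriangleFreePlanar

section Spectral

open Matrix

variable {n : Type*} [Fintype n] [DecidableEq n] {A : Matrix n n ℝ}

lemma sum_dotProduct_eigenvectorBasis (hA : A.IsHermitian) (v : n → ℝ) :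
    ∑ i, ((hA.eigenvectorBasis i).ofLp ⬝ᵥ v) • (hA.eigenvectorBasis i).ofLp = v := by
  have h := congrArg WithLp.ofLp (hA.eigenvectorBasis.sum_repr' (WithLp.toLp 2 v))
  rw [WithLp.ofLp_sum] at h
  simpa [EuclideanSpace.inner_eq_star_dotProduct, dotProduct_comm] using h

lemma eigenvectorBasis_dotProduct (hA : A.IsHermitian) (i j : n) :
    (hA.eigenvectorBasis i).ofLp ⬝ᵥ (hA.eigenvectorBasis j).ofLp = if i = j then 1 else 0 := by
  have h := orthonormal_iff_ite.1 hA.eigenvectorBasis.orthonormal i j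
  rw [EuclideanSpace.inner_eq_star_dotProduct, dotProduct_comm] at h
  simpa using h

lemma dotProduct_self_eq_sum (hA : A.IsHermitian) (v : n → ℝ) :
    v ⬝ᵥ v = ∑ i, ((hA.eigenvectorBasis i).ofLp ⬝ᵥ v) ^ 2 := by
  conv_lhs => rw [← sum_dotProduct_eigenvectorBasis hA v, sum_dotProduct]
  refine Finset.sum_congr rfl fun i _ => ?_
  rw [sum_dotProduct_eigenvectorBasis hA v, smul_dotProduct, smul_eq_mul, sq]

lemma dotProduct_mulVec_eq_sum (hA : A.IsHermitian) (v : n → ℝ) :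
    v ⬝ᵥ A *ᵥ v = ∑ i, hA.eigenvalues i * ((hA.eigenvectorBasis i).ofLp ⬝ᵥ v) ^ 2 := by
  have h : A *ᵥ v = ∑ i, ((hA.eigenvectorBasis i).ofLp ⬝ᵥ v) •
      (hA.eigenvalues i • (hA.eigenvectorBasis i).ofLp) := by
    conv_lhs => rw [← sum_dotProduct_eigenvectorBasis hA v, mulVec_sum]
    refine Finset.sum_congr rfl fun i _ => ?_
    rw [mulVec_smul, hA.mulVec_eigenvectorBasis]
  rw [h, dotProduct_sum]
  refine Finset.sum_congr rfl fun i _ => ?_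
  rw [dotProduct_smul, dotProduct_smul, dotProduct_comm v, smul_eq_mul, smul_eq_mul]
  ring

lemma dotProduct_mulVec_le_of_eigenvalues_le (hA : A.IsHermitian) {a : ℝ} {i₀ : n}
    (h : ∀ i ≠ i₀, hA.eigenvalues i ≤ a) {v : n → ℝ}
    (hv : (hA.eigenvectorBasis i₀).ofLp ⬝ᵥ v = 0) : v ⬝ᵥ A *ᵥ v ≤ a * (v ⬝ᵥ v) := by
  rw [dotProduct_mulVec_eq_sum hA, dotProduct_self_eq_sum hA, Finset.mul_sum]
  refine Finset.sum_le_sum fun i _ => ?_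
  obtain rfl | hi := eq_or_ne i i₀
  · simp [hv]
  · exact mul_le_mul_of_nonneg_right (h i hi) (sq_nonneg _)

/-- A plane spanned by two eigenvectors meets every hyperplane. -/
lemma exists_lt_dotProduct_mulVec (hA : A.IsHermitian) {a : ℝ} {i j : n} (hij : i ≠ j)
    (hi : a < hA.eigenvalues i) (hj : a < hA.eigenvalues j) (l : n → ℝ) :
    ∃ v, l ⬝ᵥ v = 0 ∧ a * (v ⬝ᵥ v) < v ⬝ᵥ A *ᵥ v := by
  obtain ⟨α, β, hne, hl⟩ : ∃ α β : ℝ, (α ≠ 0 ∨ β ≠ 0) ∧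
      α * (l ⬝ᵥ (hA.eigenvectorBasis i).ofLp) + β * (l ⬝ᵥ (hA.eigenvectorBasis j).ofLp) = 0 := by
    by_cases h : l ⬝ᵥ (hA.eigenvectorBasis i).ofLp = 0
    · exact ⟨1, 0, .inl one_ne_zero, by simp [h]⟩
    · exact ⟨-(l ⬝ᵥ (hA.eigenvectorBasis j).ofLp), _, .inr h, by ring⟩
  refine ⟨α • (hA.eigenvectorBasis i).ofLp + β • (hA.eigenvectorBasis j).ofLp, ?_, ?_⟩
  · simpa only [dotProduct_add, dotProduct_smul, smul_eq_mul] using hl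
  · simp only [mulVec_add, mulVec_smul, hA.mulVec_eigenvectorBasis, add_dotProduct, dotProduct_add,
      smul_dotProduct, dotProduct_smul, eigenvectorBasis_dotProduct, hij, hij.symm, if_true,
      if_false, smul_eq_mul]
    rcases hne with h | h
    · nlinarith [mul_pos (sq_pos_of_ne_zero h) (sub_pos.2 hi),
        mul_nonneg (sq_nonneg β) (sub_pos.2 hj).le]
    · nlinarith [mul_pos (sq_pos_of_ne_zero h) (sub_pos.2 hj),
        mul_nonneg (sq_nonneg α) (sub_pos.2 hi).le]

theorem eigenvalues₀_one_le_iff (hA : A.IsHermitian) (hn : 1 < Fintype.card n) {a : ℝ} :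
    hA.eigenvalues₀ ⟨1, hn⟩ ≤ a ↔
      ∃ l : n → ℝ, ∀ v : n → ℝ, l ⬝ᵥ v = 0 → v ⬝ᵥ A *ᵥ v ≤ a * (v ⬝ᵥ v) := by
  let e : Fin (Fintype.card n) ≃ n := Fintype.equivOfCardEq (Fintype.card_fin _)
  have hev (i) : hA.eigenvalues (e i) = hA.eigenvalues₀ i := by
    simp [Matrix.IsHermitian.eigenvalues, e]
  let zero : Fin (Fintype.card n) := ⟨0, by omega⟩
  let one : Fin (Fintype.card n) := ⟨1, hn⟩
  constructor
  · refine fun h => ⟨(hA.eigenvectorBasis (e zero)).ofLp, fun v hv =>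
      dotProduct_mulVec_le_of_eigenvalues_le hA (fun i hi => ?_) hv⟩
    obtain ⟨k, rfl⟩ := e.surjective i
    rw [hev]
    refine (hA.eigenvalues₀_antitone (Fin.le_def.2 ?_)).trans h
    exact Nat.one_le_iff_ne_zero.2 fun h0 => hi (congrArg e (Fin.ext h0))
  · rintro ⟨l, hl⟩
    by_contra! h
    have hne : e zero ≠ e one := e.injective.ne (by simp [zero, one])
    obtain ⟨v, hv, hlt⟩ := exists_lt_dotProduct_mulVec hA hne
      (by rw [hev]; exact h.trans_le (hA.eigenvalues₀_antitone (by simp [zero, Fin.le_def])))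
      (by rw [hev]; exact h) l
    exact (hl v hv).not_gt hlt

end Spectral

section ReverseCauchySchwarz

open Matrix

lemma dotProduct_mulVec_comm {n : Type*} [Fintype n] {M : Matrix n n ℝ} (hM : M.IsSymm)
    (v w : n → ℝ) : v ⬝ᵥ M *ᵥ w = w ⬝ᵥ M *ᵥ v := by
  rw [dotProduct_mulVec, ← mulVec_transpose, hM.eq, dotProduct_comm]

lemma reverse_cauchySchwarz {n : Type*} [Fintype n] {M : Matrix n n ℝ} (hM : M.IsSymm)
    {l : n → ℝ} (hl : ∀ v, l ⬝ᵥ v = 0 → 0 ≤ v ⬝ᵥ M *ᵥ v) {p : n → ℝ} (hp : p ⬝ᵥ M *ᵥ p < 0)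
    (q : n → ℝ) : p ⬝ᵥ M *ᵥ p * (q ⬝ᵥ M *ᵥ q) ≤ (p ⬝ᵥ M *ᵥ q) ^ 2 := by
  have hlp : l ⬝ᵥ p ≠ 0 := fun h => (hl p h).not_gt hp
  have h := hl ((l ⬝ᵥ q) • p - (l ⬝ᵥ p) • q) (by
    simp only [dotProduct_sub, dotProduct_smul, smul_eq_mul]; ring)
  simp only [mulVec_sub, mulVec_smul, sub_dotProduct, dotProduct_sub, smul_dotProduct,
    dotProduct_smul, smul_eq_mul, dotProduct_mulVec_comm hM q p] at h
  by_contra! hlt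
  nlinarith [mul_nonneg_of_nonpos_of_nonpos hp.le (neg_nonpos.2 h),
    sq_nonneg (l ⬝ᵥ q * (p ⬝ᵥ M *ᵥ p) - l ⬝ᵥ p * (p ⬝ᵥ M *ᵥ q)),
    mul_pos (sq_pos_of_ne_zero hlp) (sub_pos.2 hlt)]

end ReverseCauchySchwarz

section SmallLambda2

open Matrix

variable {V W : Type*} [Fintype V] [Fintype W]

/-- The spectral condition `λ₂ ≤ 1`, without reference to eigenvalues: the quadratic form of
`A - 1`, where `A` is the adjacency matrix, is nonpositive on some hyperplane. -/
def HasSmallLambda2 (G : SimpleGraph V) [DecidableRel G.Adj] : Prop :=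
  ∃ l : V → ℝ, ∀ v : V → ℝ, l ⬝ᵥ v = 0 → v ⬝ᵥ G.adjMatrix ℝ *ᵥ v ≤ v ⬝ᵥ v

theorem lambda2_le_one_iff [DecidableEq V] (G : SimpleGraph V) [DecidableRel G.Adj]
    (hV : 1 < Fintype.card V) : lambda2 G hV ≤ 1 ↔ HasSmallLambda2 G := by
  simpa only [one_mul, lambda2, HasSmallLambda2] using
    eigenvalues₀_one_le_iff (G.isHermitian_adjMatrix ℝ) hV (a := 1)

theorem HasSmallLambda2.reverse_cauchySchwarz [DecidableEq V] {G : SimpleGraph V}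
    [DecidableRel G.Adj] (hG : HasSmallLambda2 G) {p : V → ℝ}
    (hp : p ⬝ᵥ (1 - G.adjMatrix ℝ) *ᵥ p < 0) (q : V → ℝ) :
    p ⬝ᵥ (1 - G.adjMatrix ℝ) *ᵥ p * (q ⬝ᵥ (1 - G.adjMatrix ℝ) *ᵥ q) ≤
      (p ⬝ᵥ (1 - G.adjMatrix ℝ) *ᵥ q) ^ 2 := by
  obtain ⟨l, hl⟩ := hG
  refine TriangleFreePlanar.reverse_cauchySchwarz
    (isSymm_one.sub G.isSymm_adjMatrix) (l := l) (fun v hv => ?_) hp q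
  rw [sub_mulVec, one_mulVec, dotProduct_sub]
  exact sub_nonneg.2 (hl v hv)

lemma sum_mul_extend_zero (f : W ↪ V) (g : V → ℝ) (w : W → ℝ) :
    ∑ x, g x * Function.extend f w 0 x = ∑ i, g (f i) * w i := by
  classical
  rw [← Finset.sum_subset (Finset.subset_univ (Finset.univ.map f))]
  · rw [Finset.sum_map]
    exact Finset.sum_congr rfl fun i _ => by rw [f.injective.extend_apply]
  · intro x _ hx
    rw [Function.extend_apply', Pi.zero_apply, mul_zero]
    rintro ⟨i, rfl⟩
    exact hx (by simp)

lemma dotProduct_adjMatrix_mulVec_extend {G : SimpleGraph V} [DecidableRel G.Adj]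
    {H : SimpleGraph W} [DecidableRel H.Adj] (f : H ↪g G) (v w : W → ℝ) :
    Function.extend f v 0 ⬝ᵥ G.adjMatrix ℝ *ᵥ Function.extend f w 0 =
      v ⬝ᵥ H.adjMatrix ℝ *ᵥ w := by
  rw [dotProduct_comm, dotProduct_comm v]
  refine (sum_mul_extend_zero f.toEmbedding _ v).trans (Finset.sum_congr rfl fun i _ => ?_)
  congr 1
  refine (sum_mul_extend_zero f.toEmbedding _ w).trans (Finset.sum_congr rfl fun j _ => ?_)
  simp [SimpleGraph.adjMatrix_apply]

theorem HasSmallLambda2.of_embedding {G : SimpleGraph V} [DecidableRel G.Adj] {H : SimpleGraph W}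
    [DecidableRel H.Adj] (hG : HasSmallLambda2 G) (f : H ↪g G) : HasSmallLambda2 H := by
  obtain ⟨l, hl⟩ := hG
  refine ⟨fun i => l (f i), fun v hv => ?_⟩
  have hself : Function.extend f v 0 ⬝ᵥ Function.extend f v 0 = v ⬝ᵥ v :=
    (sum_mul_extend_zero f.toEmbedding _ v).trans (Finset.sum_congr rfl fun i _ => by
      rw [RelEmbedding.coe_toEmbedding, f.injective.extend_apply])
  rw [← dotProduct_adjMatrix_mulVec_extend f, ← hself]
  exact hl _ ((sum_mul_extend_zero f.toEmbedding l v).trans hv)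

theorem hasSmallLambda2_of_sum_sq [DecidableEq V] {G : SimpleGraph V} [DecidableRel G.Adj]
    (c e : ℕ) (l : V → ℤ) (D : List (ℕ × (V → ℤ)))
    (h : 0 < c ∧ c • (1 - G.adjMatrix ℤ) + e • vecMulVec l l =
      (D.map fun d => d.1 • vecMulVec d.2 d.2).sum) : HasSmallLambda2 G := by
  refine ⟨fun i => l i, fun v hv => ?_⟩
  let form : Matrix V V ℤ →+ ℝ := AddMonoidHom.mk' (fun M => v ⬝ᵥ M.map (Int.cast : ℤ → ℝ) *ᵥ v)
    fun M N => by rw [Matrix.map_add _ Int.cast_add, add_mulVec, dotProduct_add]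
  have form_vecMulVec (a : V → ℤ) : form (vecMulVec a a) = ((fun i => (a i : ℝ)) ⬝ᵥ v) ^ 2 := by
    have : (vecMulVec a a).map (Int.cast : ℤ → ℝ) =
        vecMulVec (fun i => (a i : ℝ)) fun i => (a i : ℝ) := by
      ext; simp [vecMulVec_apply]
    simp only [form, AddMonoidHom.mk'_apply, this, vecMulVec_mulVec, dotProduct_smul,
      MulOpposite.smul_eq_mul_unop, MulOpposite.unop_op, sq]
    rw [dotProduct_comm v]
  have form_one_sub : form (1 - G.adjMatrix ℤ) = v ⬝ᵥ v - v ⬝ᵥ G.adjMatrix ℝ *ᵥ v := by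
    have : (1 - G.adjMatrix ℤ).map (Int.cast : ℤ → ℝ) = 1 - G.adjMatrix ℝ := by
      ext i j; simp [SimpleGraph.adjMatrix_apply, Matrix.one_apply, apply_ite (Int.cast : ℤ → ℝ)]
    simp only [form, AddMonoidHom.mk'_apply, this, sub_mulVec, one_mulVec, dotProduct_sub]
  have hD : 0 ≤ form (D.map fun d => d.1 • vecMulVec d.2 d.2).sum := by
    rw [map_list_sum]
    refine List.sum_nonneg fun x hx => ?_
    obtain ⟨M, hM, rfl⟩ := List.mem_map.1 hx
    obtain ⟨d, -, rfl⟩ := List.mem_map.1 hM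
    rw [map_nsmul, form_vecMulVec]
    positivity
  rw [← h.2, map_add, map_nsmul, map_nsmul, form_vecMulVec, form_one_sub, hv] at hD
  have hc : (0 : ℝ) < c := Nat.cast_pos.2 h.1
  exact sub_nonneg.1 (nonneg_of_mul_nonneg_right (by simpa using hD) hc)

end SmallLambda2

section Targets

variable {s : ℕ}

instance {n : ℕ} (l : List (Fin n × Fin n)) : DecidableRel (ofEdges n l).Adj := fun a b =>
  decidable_of_iff _ (SimpleGraph.fromRel_adj _ a b).symm

instance : DecidableRel H1.Adj := inferInstanceAs (DecidableRel (ofEdges _ _).Adj)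

instance : DecidableRel H2.Adj := inferInstanceAs (DecidableRel (ofEdges _ _).Adj)

instance : DecidableRel H3.Adj := inferInstanceAs (DecidableRel (ofEdges _ _).Adj)

instance : DecidableRel H4.Adj := inferInstanceAs (DecidableRel (ofEdges _ _).Adj)

instance : DecidableRel H5.Adj := inferInstanceAs (DecidableRel (ofEdges _ _).Adj)

instance : DecidableRel H6.Adj := inferInstanceAs (DecidableRel (ofEdges _ _).Adj)

instance : DecidableRel H7.Adj := inferInstanceAs (DecidableRel (ofEdges _ _).Adj)

instance : DecidableRel H8.Adj := inferInstanceAs (DecidableRel (ofEdges _ _).Adj)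

instance : DecidableRel H9.Adj := inferInstanceAs (DecidableRel (ofEdges _ _).Adj)

instance : DecidableRel H10.Adj := inferInstanceAs (DecidableRel (ofEdges _ _).Adj)

instance : DecidableRel H11.Adj := inferInstanceAs (DecidableRel (ofEdges _ _).Adj)

instance : DecidableRel H12.Adj := inferInstanceAs (DecidableRel (ofEdges _ _).Adj)

instance : DecidableRel H13.Adj := inferInstanceAs (DecidableRel (ofEdges _ _).Adj)

lemma hasSmallLambda2_H1 : HasSmallLambda2 H1 :=
  hasSmallLambda2_of_sum_sq 1 1 ![1, 0, 1, 1, 0, 1, 1, 0]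
    [(1, ![-1, 0, 0, -1, 1, 0, 0, 0]),
     (1, ![1, -1, 1, 0, 0, 0, 1, 0]),
     (1, ![0, 0, 1, 0, 0, 1, 0, 0]),
     (1, ![0, 0, 0, 1, 0, 1, 1, -1])] (by decide +kernel)

lemma hasSmallLambda2_H2 : HasSmallLambda2 H2 :=
  hasSmallLambda2_of_sum_sq 1 1 ![1, 1, 1, 1, 0, 1, 1, 0, 0, 0]
    [(1, ![0, -1, 0, 0, 0, 0, 0, 0, 1, 0]),
     (1, ![0, 0, 0, -1, 0, 0, 0, 0, 0, 1]),
     (1, ![-1, 0, 0, 0, 0, -1, 0, 1, 0, 0]),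
     (1, ![1, 0, 1, 0, 0, 0, 0, 0, 0, 0]),
     (1, ![0, 0, 1, 0, 0, 1, 1, 0, 0, 0]),
     (1, ![0, 1, 0, 1, -1, 0, 1, 0, 0, 0])] (by decide +kernel)

lemma hasSmallLambda2_H3 : HasSmallLambda2 H3 :=
  hasSmallLambda2_of_sum_sq 1 1 ![1, 1, 1, 0, 1, 1, 0, 0, 1]
    [(1, ![-1, 0, -1, 1, 0, 0, 0, 0, 0]),
     (1, ![1, 0, 0, 0, 0, 0, -1, 0, 1]),
     (1, ![0, 1, 0, 0, 1, 0, 0, 0, 1]),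
     (1, ![0, 1, 0, 0, 0, 1, 0, 0, 0]),
     (1, ![0, 0, 1, 0, 1, 1, 0, -1, 0])] (by decide +kernel)

lemma hasSmallLambda2_H4 : HasSmallLambda2 H4 :=
  hasSmallLambda2_of_sum_sq 2 1 ![2, 1, 0, 1, 0, 0, 0, 1, 2]
    [(2, ![-1, 0, 0, 0, 0, 0, 1, 0, 0]),
     (2, ![-1, 0, 0, 0, 0, 1, 0, 0, -1]),
     (2, ![1, 0, 0, 0, -1, 0, 0, 1, 1]),
     (1, ![0, -1, 0, 1, 0, 0, 0, 1, 0]),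
     (2, ![0, 1, -1, 1, 0, 0, 0, 0, 1])] (by decide +kernel)

lemma hasSmallLambda2_H5 : HasSmallLambda2 H5 :=
  hasSmallLambda2_of_sum_sq 1 1 ![1, 1, 1, 0, 0, 1, 1, 1, 0, 0]
    [(1, ![-1, 0, -1, 1, 0, 0, 0, 0, 0, 0]),
     (1, ![1, 0, 0, 0, -1, 0, 0, 1, 0, 0]),
     (1, ![0, -1, 0, 0, 0, -1, 0, 0, 1, 0]),
     (1, ![0, 1, 0, 0, 0, 0, 1, 0, 0, -1]),
     (1, ![0, 0, 1, 0, 0, 1, 1, 1, 0, 0])] (by decide +kernel)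

lemma hasSmallLambda2_H6 : HasSmallLambda2 H6 :=
  hasSmallLambda2_of_sum_sq 1 1 ![1, 1, 1, 0, 1, 0, 1, 0, 1]
    [(1, ![-1, 0, 0, 0, 0, 1, 0, 0, 0]),
     (1, ![0, -1, 0, 0, -1, 0, 0, 1, 0]),
     (1, ![0, 1, 0, 0, 0, 0, 1, 0, 1]),
     (1, ![0, 0, 1, 0, 1, 0, 1, 0, 0]),
     (1, ![1, 0, 1, -1, 0, 0, 0, 0, 1])] (by decide +kernel)

lemma hasSmallLambda2_H7 : HasSmallLambda2 H7 :=
  hasSmallLambda2_of_sum_sq 1 1 ![1, 1, 1, 0, 1, 1, 0, 0, 1]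
    [(1, ![-1, 0, -1, 1, 0, 0, 0, 0, 0]),
     (1, ![1, 0, 0, 0, 0, 0, 0, 0, 1]),
     (1, ![0, -1, 0, 0, 0, -1, 1, 0, 0]),
     (1, ![0, 1, 0, 0, 1, 0, 0, 0, 1]),
     (1, ![0, 0, 1, 0, 1, 1, 0, -1, 0])] (by decide +kernel)

lemma hasSmallLambda2_H8 : HasSmallLambda2 H8 :=
  hasSmallLambda2_of_sum_sq 1 1 ![1, 1, 0, 1, 1, 0, 0, 1, 0]
    [(1, ![-1, 0, 0, 0, 0, 1, 0, 0, 0]),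
     (1, ![1, 0, 0, 0, 0, 0, 0, 1, 0]),
     (1, ![0, -1, 0, 0, -1, 0, 1, 0, 0]),
     (1, ![0, 0, 0, 1, 1, 0, 0, 0, -1]),
     (1, ![0, 1, -1, 1, 0, 0, 0, 1, 0])] (by decide +kernel)

lemma hasSmallLambda2_H9 : HasSmallLambda2 H9 :=
  hasSmallLambda2_of_sum_sq 1 1 ![1, 1, 0, 1, 0, 0, 1, 0, 1]
    [(1, ![-1, 0, 0, 0, 0, 1, 0, 0, 0]),
     (1, ![0, -1, 0, 0, 0, 0, 0, 1, 0]),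
     (1, ![1, 0, 0, 0, -1, 0, 1, 0, 1]),
     (1, ![0, 0, 0, 1, 0, 0, 1, 0, 0]),
     (1, ![0, 1, -1, 1, 0, 0, 0, 0, 1])] (by decide +kernel)

lemma hasSmallLambda2_H10 : HasSmallLambda2 H10 :=
  hasSmallLambda2_of_sum_sq 1 1 ![1, 0, 1, 1, 0, 2, 0, 1]
    [(2, ![0, 0, 0, 1, 0, 1, 0, 0]),
     (1, ![-1, 1, -1, 0, 0, -1, 0, 0]),
     (1, ![1, 0, 0, 0, -1, 1, 0, 1]),
     (1, ![0, 0, 1, 0, 0, 1, -1, 1])] (by decide +kernel)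

lemma hasSmallLambda2_H11 : HasSmallLambda2 H11 :=
  hasSmallLambda2_of_sum_sq 3 1 ![2, 3, -1, 3, 2, 3, 0, 0, 0, 0]
    [(3, ![-1, 0, 0, 0, 0, 0, 0, 1, 0, 0]),
     (3, ![0, -1, 0, 0, 0, 0, 0, 0, 1, 0]),
     (3, ![0, 0, 0, -1, 0, 0, 0, 0, 0, 1]),
     (3, ![-1, 0, 0, 0, -1, 0, 1, 0, 0, 0]),
     (1, ![1, 3, -2, 3, 1, 3, 0, 0, 0, 0]),
     (3, ![0, 0, 0, 0, 1, 1, 0, 0, 0, 0])] (by decide +kernel)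

lemma hasSmallLambda2_H12 : HasSmallLambda2 H12 :=
  hasSmallLambda2_of_sum_sq 6 2 ![1, 3, 7, 4, 3, 0, 4, 1, -2, 0]
    [(6, ![0, 0, 0, -1, 0, 0, 0, 0, 0, 1]),
     (6, ![-1, 0, -1, 0, 0, 1, 0, 0, 0, 0]),
     (6, ![0, 2, 3, 2, 1, 0, 2, 0, -1, 0]),
     (2, ![1, 0, 4, 1, 3, 0, 1, 1, -2, 0]),
     (3, ![0, 0, 2, 1, 0, 0, 2, 1, 0, 0]),
     (3, ![0, 0, 0, 1, 0, 0, 0, 1, 0, 0])] (by decide +kernel)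

lemma hasSmallLambda2_H13 : HasSmallLambda2 H13 :=
  hasSmallLambda2_of_sum_sq 5 1 ![5, 3, 5, 3, 0, -2, 0, 0, 0, 0]
    [(5, ![-1, 0, 0, 0, 0, 0, 1, 0, 0, 0]),
     (5, ![0, -1, 0, 0, 0, 0, 0, 1, 0, 0]),
     (5, ![0, 0, -1, 0, 0, 0, 0, 0, 1, 0]),
     (5, ![0, 0, 0, -1, 0, 0, 0, 0, 0, 1]),
     (5, ![0, -1, 0, -1, 1, 0, 0, 0, 0, 0]),
     (1, ![5, 2, 5, 2, 0, -3, 0, 0, 0, 0])] (by decide +kernel)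

/-- The vertices of `F1 s` as a sum type, through which finiteness and decidable equality are
transported. -/
def F1Vertex.equivSum (s : ℕ) : F1Vertex s ≃ (Unit ⊕ Unit) ⊕ (Fin s ⊕ Fin s) where
  toFun
    | .v1 => .inl (.inl ())
    | .v2 => .inl (.inr ())
    | .u i => .inr (.inl i)
    | .w i => .inr (.inr i)
  invFun
    | .inl (.inl ()) => .v1
    | .inl (.inr ()) => .v2
    | .inr (.inl i) => .u i
    | .inr (.inr i) => .w i
  left_inv x := by cases x <;> rfl
  right_inv x := by rcases x with (x | x) | (x | x) <;> rfl

instance : Fintype (F1Vertex s) := Fintype.ofEquiv _ (F1Vertex.equivSum s).symm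

instance : DecidableEq (F1Vertex s) := (F1Vertex.equivSum s).decidableEq

instance : DecidableRel (F1Edge s) := fun a b => by
  cases a <;> cases b <;> simp only [F1Edge] <;> infer_instance

instance : DecidableRel (F1 s).Adj := fun a b =>
  decidable_of_iff _ (SimpleGraph.fromRel_adj _ a b).symm

lemma F1_adj {a b : F1Vertex s} : (F1 s).Adj a b ↔ a ≠ b ∧ (F1Edge s a b ∨ F1Edge s b a) :=
  SimpleGraph.fromRel_adj _ a b

lemma F1Vertex.sum_eq (g : F1Vertex s → ℝ) :
    ∑ x, g x = g .v1 + g .v2 + ∑ i, (g (.u i) + g (.w i)) := by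
  rw [← (F1Vertex.equivSum s).symm.sum_comp g, Fintype.sum_sum_type, Fintype.sum_sum_type,
    Fintype.sum_sum_type, Finset.sum_add_distrib]
  simp [F1Vertex.equivSum]

section

open Matrix

variable (v : F1Vertex s → ℝ)

lemma F1_adjMatrix_mulVec_v1 : ((F1 s).adjMatrix ℝ *ᵥ v) .v1 =
    ∑ i : Fin s, if i.val < 2 then v (.w i) else v (.u i) := by
  rw [mulVec, dotProduct, F1Vertex.sum_eq]
  simp only [SimpleGraph.adjMatrix_apply, F1_adj, F1Edge, ite_mul]
  simp only [ne_eq, not_true_eq_false, or_self, and_false, if_false, reduceCtorEq,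
    not_false_eq_true, or_false, true_and, one_mul, zero_mul, zero_add]
  exact Finset.sum_congr rfl fun i _ => by split_ifs <;> first | omega | simp

lemma F1_adjMatrix_mulVec_v2 : ((F1 s).adjMatrix ℝ *ᵥ v) .v2 = ∑ i : Fin s, v (.u i) := by
  simp [mulVec, dotProduct, F1Vertex.sum_eq, F1_adj, F1Edge]

lemma F1_adjMatrix_mulVec_u (i : Fin s) : ((F1 s).adjMatrix ℝ *ᵥ v) (.u i) =
    v .v2 + v (.w i) + if i.val < 2 then 0 else v .v1 := by
  suffices (if 2 ≤ i.val then v .v1 else 0) + v .v2 + v (.w i) =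
      v .v2 + v (.w i) + if i.val ≤ 1 then 0 else v .v1 by
    simpa [mulVec, dotProduct, F1Vertex.sum_eq, F1_adj, F1Edge]
  split_ifs <;> first | omega | ring

lemma F1_adjMatrix_mulVec_w (i : Fin s) : ((F1 s).adjMatrix ℝ *ᵥ v) (.w i) =
    v (.u i) + if i.val < 2 then v .v1 else 0 := by
  simp [mulVec, dotProduct, F1Vertex.sum_eq, F1_adj, F1Edge, add_comm]

end

/-- The contribution of one index `i` to the form of `1 - A` on `F1 s`, plus a multiple of a linear
form, is the square of `w - u - (a - b) / 2` or of `w - u`. Here `ε` is `1` for the two subdivided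
edges and `0` for the others. -/
lemma F1_local_form_nonneg (a b u w : ℝ) {ε : ℝ} (hε : ε = 0 ∨ ε = 1) :
    0 ≤ u * u + w * w - u * (b + w + (1 - ε) * a) - w * (u + ε * a) -
      (a * (ε * w + (1 - ε) * u) + b * u) +
      ((a + b) * ((2 - ε) * u + ε * w) + (a - b) ^ 2 / 4 * ε) := by
  rcases hε with rfl | rfl
  · linarith [sq_nonneg (w - u)]
  · linarith [sq_nonneg (w - u - (a - b) / 2)]

lemma sum_lt_two_le (s : ℕ) : ∑ i : Fin s, (if i.val < 2 then (1 : ℝ) else 0) ≤ 2 := by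
  rw [Finset.sum_boole]
  have : (Finset.univ.filter fun i : Fin s => i.val < 2).card ≤ (Finset.range 2).card :=
    Finset.card_le_card_of_injOn (fun i => i.val)
      (fun i hi => by simpa using hi) (fun i _ j _ h => Fin.ext h)
  exact_mod_cast this

theorem hasSmallLambda2_F1 : HasSmallLambda2 (F1 s) := by
  let ε (i : Fin s) : ℝ := if i.val < 2 then 1 else 0
  refine ⟨fun | .v1 => 0 | .v2 => 0 | .u i => 2 - ε i | .w i => ε i, fun v hv => ?_⟩
  rw [dotProduct, F1Vertex.sum_eq] at hv
  simp only [zero_mul, zero_add] at hv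
  have hu (i : Fin s) (a : ℝ) : (if i.val < 2 then 0 else a) = (1 - ε i) * a := by
    simp only [ε]; split_ifs <;> ring
  have hw (i : Fin s) (a : ℝ) : (if i.val < 2 then a else 0) = ε i * a := by
    simp only [ε]; split_ifs <;> ring
  have huw (i : Fin s) (a b : ℝ) : (if i.val < 2 then b else a) = ε i * b + (1 - ε i) * a := by
    simp only [ε]; split_ifs <;> ring
  rw [dotProduct, dotProduct, F1Vertex.sum_eq, F1Vertex.sum_eq, F1_adjMatrix_mulVec_v1,
    F1_adjMatrix_mulVec_v2]
  simp only [F1_adjMatrix_mulVec_u, F1_adjMatrix_mulVec_w, hu, hw, huw]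
  have hsum := Finset.sum_nonneg fun i (_ : i ∈ Finset.univ) =>
    F1_local_form_nonneg (v .v1) (v .v2) (v (.u i)) (v (.w i)) (ε := ε i)
      (by simp only [ε]; split_ifs <;> simp)
  simp only [Finset.sum_add_distrib, Finset.sum_sub_distrib, ← Finset.mul_sum] at hsum hv ⊢
  rw [hv] at hsum
  nlinarith [sq_nonneg (v .v1 + v .v2), mul_le_mul_of_nonneg_left (sum_lt_two_le s)
    (by positivity : (0 : ℝ) ≤ (v .v1 - v .v2) ^ 2 / 4)]

end Targets

section ResidualGram

open Matrix

variable {V : Type*} {G : SimpleGraph V}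

lemma not_adj_of_cliqueFree_three (h : G.CliqueFree 3) {a b c : V} (hab : G.Adj a b)
    (hac : G.Adj a c) : ¬ G.Adj b c := fun hbc => by
  classical exact h {a, b, c} (SimpleGraph.is3Clique_triple_iff.2 ⟨hab, hac, hbc⟩)

variable [Fintype V] [DecidableRel G.Adj]

/-- The number of common neighbours of `c`, `x` and `y`. -/
def overlap (G : SimpleGraph V) [DecidableRel G.Adj] (c x y : V) : ℕ :=
  (Finset.univ.filter fun i => G.Adj c i ∧ G.Adj x i ∧ G.Adj y i).card

lemma overlap_comm (c x y : V) : overlap G c x y = overlap G c y x := by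
  simp only [overlap, and_comm (a := G.Adj x _)]

lemma overlap_self_left (c : V) : overlap G c c c = G.degree c := by
  simp only [overlap, and_self]
  rw [← SimpleGraph.card_neighborFinset_eq_degree, SimpleGraph.neighborFinset_eq_filter]

lemma overlap_eq_zero_of_adj_left (htri : G.CliqueFree 3) {c i : V} (h : G.Adj c i) (x : V) :
    overlap G c i x = 0 := by
  simp only [overlap, Finset.card_eq_zero, Finset.filter_eq_empty_iff]
  exact fun j _ hj => not_adj_of_cliqueFree_three htri h hj.1 hj.2.1

lemma overlap_eq_zero_of_adj (htri : G.CliqueFree 3) {x y : V} (h : G.Adj x y) (c : V) :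
    overlap G c x y = 0 := by
  simp only [overlap, Finset.card_eq_zero, Finset.filter_eq_empty_iff]
  exact fun j _ hj => not_adj_of_cliqueFree_three htri h hj.2.1 hj.2.2

lemma adjMatrix_mulVec_adjMatrix_apply (c x : V) :
    (G.adjMatrix ℝ *ᵥ G.adjMatrix ℝ c) x = overlap G c x x := by
  simp only [overlap, mulVec, dotProduct, SimpleGraph.adjMatrix_apply, Finset.card_filter,
    Nat.cast_sum]
  exact Finset.sum_congr rfl fun i _ => by split_ifs <;> simp_all

lemma adjMatrix_apply_mul_adjMatrix_mulVec (htri : G.CliqueFree 3) (c i : V) :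
    G.adjMatrix ℝ c i * (G.adjMatrix ℝ *ᵥ G.adjMatrix ℝ c) i = 0 := by
  rw [SimpleGraph.adjMatrix_apply, adjMatrix_mulVec_adjMatrix_apply]
  split_ifs with h
  · rw [overlap_eq_zero_of_adj_left htri h, Nat.cast_zero, mul_zero]
  · rw [zero_mul]

lemma adjMatrix_dotProduct_mulVec_self (htri : G.CliqueFree 3) (c : V) :
    G.adjMatrix ℝ c ⬝ᵥ G.adjMatrix ℝ *ᵥ G.adjMatrix ℝ c = 0 :=
  Finset.sum_eq_zero fun i _ => adjMatrix_apply_mul_adjMatrix_mulVec htri c i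

variable [DecidableEq V]

lemma adjMatrix_mul_diagonal_mul_apply (c x y : V) :
    (G.adjMatrix ℝ * diagonal (G.adjMatrix ℝ c) * G.adjMatrix ℝ) x y = overlap G c x y := by
  rw [Matrix.mul_apply]
  simp only [overlap, mul_diagonal, SimpleGraph.adjMatrix_apply, Finset.card_filter, Nat.cast_sum]
  exact Finset.sum_congr rfl fun i _ => by split_ifs <;> simp_all [G.adj_comm]

lemma diagonal_mul_adjMatrix_mul_diagonal (htri : G.CliqueFree 3) (c : V) :
    diagonal (G.adjMatrix ℝ c) * G.adjMatrix ℝ * diagonal (G.adjMatrix ℝ c) = 0 := by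
  ext i j
  rw [mul_diagonal, diagonal_mul, Matrix.zero_apply]
  simp only [SimpleGraph.adjMatrix_apply]
  split_ifs with hi hij hj <;>
    first
    | exact absurd hij (not_adj_of_cliqueFree_three htri hi hj)
    | simp only [mul_zero, zero_mul]

/-- Up to the factor `d - 1`, where `d` is the degree of `c`, the Schur complement of the star with
centre `c` in `1 - A`. It is indexed by all vertices, but only the entries indexed by vertices
outside the star are meaningful. -/
def residualGram (G : SimpleGraph V) [DecidableRel G.Adj] (c : V) : Matrix V V ℤ := of fun x y =>
  (G.degree c - 1) * ((if x = y then 1 else 0) - (if G.Adj x y then 1 else 0) - overlap G c x y) +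
    overlap G c x x * overlap G c y y

lemma residualGram_comm (c x y : V) : residualGram G c x y = residualGram G c y x := by
  simp only [residualGram, of_apply, overlap_comm c x y, G.adj_comm x y, eq_comm (a := x)]
  ring

lemma residualGram_self (c x : V) : residualGram G c x x =
    (G.degree c - 1) * (1 - overlap G c x x) + overlap G c x x * overlap G c x x := by
  simp [residualGram]

lemma residualGram_of_not_adj {x y : V} (hne : x ≠ y) (hadj : ¬ G.Adj x y) (c : V) :
    residualGram G c x y =
      overlap G c x x * overlap G c y y - (G.degree c - 1) * overlap G c x y := by
  simp only [residualGram, of_apply, if_neg hne, if_neg hadj]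
  ring

lemma residualGram_of_adj (htri : G.CliqueFree 3) {x y : V} (hadj : G.Adj x y) (c : V) :
    residualGram G c x y = overlap G c x x * overlap G c y y - (G.degree c - 1) := by
  simp only [residualGram, of_apply, if_neg hadj.ne, if_pos hadj,
    overlap_eq_zero_of_adj htri hadj]
  push_cast
  ring

lemma residualGram_map_intCast (c : V) : (residualGram G c).map (Int.cast : ℤ → ℝ) =
    ((G.degree c : ℝ) - 1) •
      (1 - G.adjMatrix ℝ - G.adjMatrix ℝ * diagonal (G.adjMatrix ℝ c) * G.adjMatrix ℝ) +
    vecMulVec (G.adjMatrix ℝ *ᵥ G.adjMatrix ℝ c) (G.adjMatrix ℝ *ᵥ G.adjMatrix ℝ c) := by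
  ext x y
  simp only [residualGram, map_apply, of_apply, Matrix.add_apply, Matrix.smul_apply,
    Matrix.sub_apply, smul_eq_mul, adjMatrix_mul_diagonal_mul_apply, vecMulVec_apply,
    adjMatrix_mulVec_adjMatrix_apply, one_apply, SimpleGraph.adjMatrix_apply]
  push_cast
  rfl

lemma one_sub_adjMatrix_mulVec_star (c : V) :
    (1 - G.adjMatrix ℝ) *ᵥ (G.adjMatrix ℝ c + Pi.single c 1) =
      Pi.single c 1 - G.adjMatrix ℝ *ᵥ G.adjMatrix ℝ c := by
  have hsingle : G.adjMatrix ℝ *ᵥ Pi.single c 1 = G.adjMatrix ℝ c := by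
    ext i; simp [SimpleGraph.adjMatrix_apply, G.adj_comm]
  rw [sub_mulVec, one_mulVec, mulVec_add, hsingle]
  abel

lemma star_form (htri : G.CliqueFree 3) (c : V) :
    (G.adjMatrix ℝ c + Pi.single c 1) ⬝ᵥ
      (1 - G.adjMatrix ℝ) *ᵥ (G.adjMatrix ℝ c + Pi.single c 1) = 1 - (G.degree c : ℝ) := by
  rw [one_sub_adjMatrix_mulVec_star, add_dotProduct, dotProduct_sub, dotProduct_sub,
    adjMatrix_dotProduct_mulVec_self htri, single_one_dotProduct, single_one_dotProduct,
    dotProduct_single_one, adjMatrix_mulVec_adjMatrix_apply, overlap_self_left]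
  simp

/-- Adding `s = diag(a) A t`, where `a` is the row of `c`, to a vector `t` supported outside the
star makes it orthogonal to the leaves for the form of `1 - A`. -/
lemma off_star_form (htri : G.CliqueFree 3) {c : V} {t : V → ℝ}
    (ht : ∀ i, G.adjMatrix ℝ c i * t i = 0) :
    (t + diagonal (G.adjMatrix ℝ c) *ᵥ G.adjMatrix ℝ *ᵥ t) ⬝ᵥ
      (1 - G.adjMatrix ℝ) *ᵥ (t + diagonal (G.adjMatrix ℝ c) *ᵥ G.adjMatrix ℝ *ᵥ t) =
    t ⬝ᵥ (1 - G.adjMatrix ℝ - G.adjMatrix ℝ * diagonal (G.adjMatrix ℝ c) * G.adjMatrix ℝ) *ᵥ t := by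
  set A := G.adjMatrix ℝ with hA
  set D := diagonal (A c) with hD
  have hAt : Aᵀ = A := SimpleGraph.transpose_adjMatrix G
  have hDt : Dᵀ = D := diagonal_transpose _
  have hDD : D * D = D := by
    rw [hD, diagonal_mul_diagonal]
    congr 1
    ext i
    simp [hA, SimpleGraph.adjMatrix_apply]
  have htD : D *ᵥ t = 0 := by ext i; rw [hD, mulVec_diagonal]; exact ht i
  have hts (w : V → ℝ) : t ⬝ᵥ D *ᵥ w = 0 := by
    rw [dotProduct_mulVec, ← mulVec_transpose, hDt, htD, zero_dotProduct]
  have hs (w : V → ℝ) : D *ᵥ A *ᵥ t ⬝ᵥ w = t ⬝ᵥ A *ᵥ D *ᵥ w := by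
    rw [dotProduct_mulVec t, ← mulVec_transpose, hAt, dotProduct_mulVec _ D, ← mulVec_transpose,
      hDt]
  have hDAD (w : V → ℝ) : D *ᵥ A *ᵥ D *ᵥ w = 0 := by
    rw [mulVec_mulVec, mulVec_mulVec, diagonal_mul_adjMatrix_mul_diagonal htri, zero_mulVec]
  have hDD' (w : V → ℝ) : D *ᵥ D *ᵥ w = D *ᵥ w := by rw [mulVec_mulVec, hDD]
  simp only [sub_mulVec, one_mulVec, mulVec_add, add_dotProduct, dotProduct_add, dotProduct_sub,
    hts, hs, hDAD, hDD', htD, mulVec_zero, dotProduct_zero, ← mulVec_mulVec]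
  ring

/-- This is the reverse Cauchy–Schwarz inequality for the indicator `p` of the star and the
projection `q` of `t` to the orthogonal complement of the leaves. -/
lemma HasSmallLambda2.residualGram_form_nonneg (hG : HasSmallLambda2 G) (htri : G.CliqueFree 3)
    {c : V} (hc : 0 < G.degree c) {t : V → ℝ} (htc : t c = 0)
    (ht : ∀ i, G.adjMatrix ℝ c i * t i = 0) :
    0 ≤ t ⬝ᵥ (residualGram G c).map (Int.cast : ℤ → ℝ) *ᵥ t := by
  let a := G.adjMatrix ℝ c
  let p : V → ℝ := a + Pi.single c 1
  let q : V → ℝ := t + diagonal a *ᵥ G.adjMatrix ℝ *ᵥ t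
  have hpp : p ⬝ᵥ (1 - G.adjMatrix ℝ) *ᵥ p = 1 - (G.degree c : ℝ) := star_form htri c
  have hqc : q c = 0 := by simp [q, a, htc, mulVec_diagonal, -mulVec_mulVec]
  have hpq : p ⬝ᵥ (1 - G.adjMatrix ℝ) *ᵥ q = -((G.adjMatrix ℝ *ᵥ a) ⬝ᵥ t) := by
    rw [dotProduct_mulVec_comm (isSymm_one.sub G.isSymm_adjMatrix), one_sub_adjMatrix_mulVec_star,
      dotProduct_sub, dotProduct_single_one, hqc, zero_sub, dotProduct_comm, dotProduct_add]
    suffices (G.adjMatrix ℝ *ᵥ a) ⬝ᵥ diagonal a *ᵥ G.adjMatrix ℝ *ᵥ t = 0 by rw [this, add_zero]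
    refine Finset.sum_eq_zero fun i _ => ?_
    rw [mulVec_diagonal, ← mul_assoc, mul_comm _ (a i),
      adjMatrix_apply_mul_adjMatrix_mulVec htri c i, zero_mul]
  rw [residualGram_map_intCast, add_mulVec, smul_mulVec, dotProduct_add, dotProduct_smul,
    ← off_star_form htri ht, vecMulVec_mulVec, dotProduct_smul, dotProduct_comm t]
  rw [MulOpposite.smul_eq_mul_unop, MulOpposite.unop_op, smul_eq_mul, ← sq, ← neg_sq, ← hpq]
  obtain h1 | h1 : G.degree c = 1 ∨ 1 < G.degree c := by omega
  · rw [h1, Nat.cast_one, sub_self, zero_mul, zero_add]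
    exact sq_nonneg _
  · have h1' : (1 : ℝ) < G.degree c := by exact_mod_cast h1
    have := hG.reverse_cauchySchwarz (by rw [hpp]; linarith) q
    rw [hpp] at this
    linarith

theorem HasSmallLambda2.residualGram_posSemidef (hG : HasSmallLambda2 G) (htri : G.CliqueFree 3)
    {c : V} (hc : 0 < G.degree c) {ι : Type*} {f : ι → V}
    (hf : ∀ i, f i ≠ c ∧ ¬ G.Adj c (f i)) :
    (((residualGram G c).submatrix f f).map (Int.cast : ℤ → ℝ)).PosSemidef := by
  classical
  set P := (residualGram G c).map (Int.cast : ℤ → ℝ) with hP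
  let χ : V → ℝ := fun x => if x ≠ c ∧ ¬ G.Adj c x then 1 else 0
  have hmask : (diagonal χ * P * diagonal χ).PosSemidef := by
    refine .of_dotProduct_mulVec_nonneg ?_ fun v => ?_
    · ext x y
      simp only [conjTranspose_apply, mul_diagonal, diagonal_mul, star_trivial, hP, map_apply,
        residualGram_comm c x y]
      ring
    · have h := hG.residualGram_form_nonneg htri hc (t := diagonal χ *ᵥ v)
        (by simp [mulVec_diagonal, χ]) fun i => by
          rw [mulVec_diagonal, SimpleGraph.adjMatrix_apply]
          split_ifs with hi <;> simp [χ, hi]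
      rwa [star_trivial, ← mulVec_mulVec, ← mulVec_mulVec, dotProduct_mulVec,
        ← mulVec_transpose, diagonal_transpose]
  convert hmask.submatrix f using 1
  ext i j
  simp [mul_diagonal, diagonal_mul, χ, hf, hP]

theorem HasSmallLambda2.residualGram_det_nonneg (hG : HasSmallLambda2 G) (htri : G.CliqueFree 3)
    {c : V} (hc : 0 < G.degree c) {ι : Type*} [Fintype ι] [DecidableEq ι] {f : ι → V}
    (hf : ∀ i, f i ≠ c ∧ ¬ G.Adj c (f i)) : 0 ≤ ((residualGram G c).submatrix f f).det := by
  have h := (hG.residualGram_posSemidef htri hc hf).det_nonneg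
  rwa [← Int.cast_det, Int.cast_nonneg_iff] at h

lemma HasSmallLambda2.residualGram_self_nonneg (hG : HasSmallLambda2 G) (htri : G.CliqueFree 3)
    {c : V} (hc : 0 < G.degree c) {x : V} (hx : x ≠ c ∧ ¬ G.Adj c x) :
    0 ≤ residualGram G c x x := by
  simpa using hG.residualGram_det_nonneg htri hc (f := fun _ : Fin 1 => x) fun _ => hx

lemma HasSmallLambda2.residualGram_sq_le (hG : HasSmallLambda2 G) (htri : G.CliqueFree 3)
    {c : V} (hc : 0 < G.degree c) {x y : V} (hx : x ≠ c ∧ ¬ G.Adj c x) (hy : y ≠ c ∧ ¬ G.Adj c y) :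
    residualGram G c x y * residualGram G c x y ≤ residualGram G c x x * residualGram G c y y := by
  have h := hG.residualGram_det_nonneg htri hc (f := ![x, y]) (by simp [Fin.forall_fin_two, *])
  simp only [det_fin_two, submatrix_apply, cons_val_zero, cons_val_one] at h
  rw [residualGram_comm c y x] at h
  linarith

lemma HasSmallLambda2.residualGram_det_three_nonneg (hG : HasSmallLambda2 G)
    (htri : G.CliqueFree 3) {c : V} (hc : 0 < G.degree c) {x y z : V} (hx : x ≠ c ∧ ¬ G.Adj c x)
    (hy : y ≠ c ∧ ¬ G.Adj c y) (hz : z ≠ c ∧ ¬ G.Adj c z) :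
    0 ≤ residualGram G c x x * residualGram G c y y * residualGram G c z z +
      2 * residualGram G c x y * residualGram G c x z * residualGram G c y z -
      residualGram G c x x * residualGram G c y z * residualGram G c y z -
      residualGram G c y y * residualGram G c x z * residualGram G c x z -
      residualGram G c z z * residualGram G c x y * residualGram G c x y := by
  have h := hG.residualGram_det_nonneg htri hc (f := ![x, y, z])
    (by simp [Fin.forall_fin_succ, *])
  simp only [det_fin_three, submatrix_apply, cons_val_zero, cons_val_one, cons_val] at h
  rw [residualGram_comm c y x, residualGram_comm c z x, residualGram_comm c z y] at h
  linarith

end ResidualGram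

section Codes

variable {α β γ V W : Type*}

/-- Folding a list from the right, by the bare recursor of lists. The kernel evaluates it much
faster than a function defined by structural recursion, hence its use in the definitions on which
the finite search depends. -/
noncomputable def fold (f : α → β → β) (b : β) (l : List α) : β :=
  List.rec b (fun a _ ih => f a ih) l

/-- The list of the values of `f` on corresponding entries of two lists, as a `fold`. -/
noncomputable def foldZipWith (f : α → β → γ) : List α → List β → List γ :=
  fold (fun a ih l => List.rec [] (fun b l _ => f a b :: ih l) l) fun _ => []

lemma foldZipWith_eq_zipWith (f : α → β → γ) (l : List α) (l' : List β) :
    foldZipWith f l l' = l.zipWith f l' := by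
  induction l generalizing l' with
  | nil => cases l' <;> rfl
  | cons a l ih =>
    cases l' with
    | nil => rfl
    | cons b l' => exact congrArg (f a b :: ·) (ih l')

/-- The natural number with a given list of binary digits, the last significant first. -/
noncomputable def mask : List Bool → ℕ := fold Nat.bit 0

lemma mask_cons (b : Bool) (l : List Bool) : mask (b :: l) = Nat.bit b (mask l) := rfl

lemma testBit_mask (l : List Bool) (i : ℕ) : (mask l).testBit i = l[i]?.getD false := by
  induction l generalizing i with
  | nil => exact Nat.zero_testBit i
  | cons b l ih =>
    rw [mask_cons]
    cases i with
    | zero => exact Nat.testBit_bit_zero b _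
    | succ i => rw [Nat.testBit_bit_succ, ih, List.getElem?_cons_succ]

/-- The part of an adjacency matrix above the diagonal, row by row. -/
abbrev Code := List (List Bool)

/-- The code of the subgraph induced by a list of vertices. -/
def codeOf (G : SimpleGraph V) [DecidableRel G.Adj] : List V → Code
  | [] => []
  | v :: L => (L.map fun w => decide (G.Adj v w)) :: codeOf G L

variable {G : SimpleGraph V} {H : SimpleGraph W} [DecidableRel G.Adj] [DecidableRel H.Adj]

lemma length_codeOf (P : List V) : (codeOf G P).length = P.length := by
  induction P with
  | nil => rfl
  | cons _ _ ih => exact congrArg (· + 1) ih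

lemma adj_getElem_iff_of_codeOf_eq {P : List V} {L : List W} (h : codeOf G P = codeOf H L)
    {i j : ℕ} (hi : i < P.length) (hj : j < P.length) (hi' : i < L.length) (hj' : j < L.length) :
    G.Adj P[i] P[j] ↔ H.Adj L[i] L[j] := by
  induction P generalizing L i j with
  | nil => exact absurd hi (Nat.not_lt_zero i)
  | cons v P ih =>
    cases L with
    | nil => exact absurd hi' (Nat.not_lt_zero i)
    | cons w L =>
      obtain ⟨hrow, hcode⟩ := List.cons.inj h
      have hfirst {k : ℕ} (hk : k < P.length) (hk' : k < L.length) :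
          G.Adj v P[k] ↔ H.Adj w L[k] := by
        have := congrArg (·[k]?) hrow
        simpa [hk, hk'] using this
      cases i <;> cases j
      · exact iff_of_false (G.irrefl) (H.irrefl)
      · exact hfirst (Nat.lt_of_succ_lt_succ hj) (Nat.lt_of_succ_lt_succ hj')
      · rw [G.adj_comm, H.adj_comm]
        exact hfirst (Nat.lt_of_succ_lt_succ hi) (Nat.lt_of_succ_lt_succ hi')
      · exact ih hcode (Nat.lt_of_succ_lt_succ hi) (Nat.lt_of_succ_lt_succ hj)
          (Nat.lt_of_succ_lt_succ hi') (Nat.lt_of_succ_lt_succ hj')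

lemma isIndContained_of_codeOf_eq {P : List V} {L : List W} (h : codeOf G P = codeOf H L)
    (hP : ∀ v, v ∈ P) (hL : L.Nodup) : G.IsIndContained H := by
  classical
  have hlen : L.length = P.length := by rw [← length_codeOf (G := H), ← h, length_codeOf]
  have hidx (v : V) : P.idxOf v < P.length := List.idxOf_lt_length_of_mem (hP v)
  refine ⟨⟨⟨fun v => L[P.idxOf v]'(hlen ▸ hidx v), fun v w hvw => ?_⟩, fun {v w} => ?_⟩⟩
  · exact (List.idxOf_inj (hP v)).1 (hL.getElem_inj_iff.1 hvw)
  · have := adj_getElem_iff_of_codeOf_eq h (hidx v) (hidx w) (hlen ▸ hidx v) (hlen ▸ hidx w)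
    rw [List.getElem_idxOf, List.getElem_idxOf] at this
    exact this.symm

/-- The number of entries `true`, as a `fold`. -/
noncomputable def countTrue : List Bool → ℕ := fold (fun b k => bif b then k + 1 else k) 0

lemma countTrue_map (p : α → Bool) (l : List α) : countTrue (l.map p) = l.countP p := by
  induction l with
  | nil => rfl
  | cons a l ih =>
    change (bif p a then countTrue (l.map p) + 1 else countTrue (l.map p)) = _
    rw [ih, List.countP_cons]
    cases p a <;> rfl

/-- The degrees of the vertices of a graph, computed from its code. -/
noncomputable def Code.degrees : Code → List ℕ :=
  fold (fun r S => countTrue r :: foldZipWith (fun b d => bif b then d + 1 else d) r S) []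

lemma degrees_codeOf (L : List V) :
    (codeOf G L).degrees = L.map fun v => L.countP fun w => G.Adj v w := by
  induction L with
  | nil => rfl
  | cons v L ih =>
    change countTrue _ :: foldZipWith _ _ (codeOf G L).degrees = _
    rw [ih, countTrue_map, foldZipWith_eq_zipWith, List.zipWith_map, List.zipWith_self]
    simp only [List.map_cons, List.countP_cons, G.irrefl, if_false, add_zero, decide_eq_true_eq,
      G.adj_comm v, Bool.cond_decide]
    congr 1
    exact List.map_congr_left fun w _ => by split_ifs <;> rfl

lemma le_of_mem_degrees_codeOf [Fintype V] {L : List V} (hL : L.Nodup) {D d : ℕ}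
    (hD : ∀ v, G.degree v ≤ D) (hd : d ∈ (codeOf G L).degrees) : d ≤ D := by
  classical
  rw [degrees_codeOf, List.mem_map] at hd
  obtain ⟨v, -, rfl⟩ := hd
  refine le_trans ?_ (hD v)
  rw [List.countP_eq_length_filter, ← List.toFinset_card_of_nodup (hL.filter _)]
  exact Finset.card_le_card fun w hw => by
    simpa using (List.mem_filter.1 (List.mem_toFinset.1 hw)).2

/-- For each vertex of a graph, the sets of its neighbours and of the other vertices different from
it, as bit masks. -/
noncomputable def Code.profiles : Code → List (ℕ × ℕ) :=
  fold (fun r S => (Nat.bit false (mask r), Nat.bit false (mask (r.map not))) ::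
      foldZipWith (fun b p => (Nat.bit b p.1, Nat.bit (!b) p.2)) r S) []

/-- The entry of `Code.profiles` for a vertex of the list of vertices `L`. -/
noncomputable def profile [DecidableEq W] (H : SimpleGraph W) [DecidableRel H.Adj] (L : List W)
    (v : W) : ℕ × ℕ :=
  (mask (L.map fun w => H.Adj v w), mask (L.map fun w => v ≠ w ∧ ¬ H.Adj v w))

lemma profiles_codeOf [DecidableEq W] {L : List W} (hL : L.Nodup) :
    (codeOf H L).profiles = L.map (profile H L) := by
  induction L with
  | nil => rfl
  | cons v L ih =>
    obtain ⟨hv, hL⟩ := List.nodup_cons.1 hL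
    change _ :: foldZipWith _ _ (codeOf H L).profiles = _
    rw [ih hL, foldZipWith_eq_zipWith, List.zipWith_map, List.zipWith_self, List.map_cons]
    congr 1
    · have hne : ∀ w ∈ L, v ≠ w := fun w hw h => hv (h ▸ hw)
      simp only [profile, List.map_cons, mask_cons, H.irrefl, ne_eq, not_true_eq_false, false_and,
        decide_false, List.map_map]
      congr 3
      refine List.map_congr_left fun w hw => ?_
      simp [hne w hw]
    · refine List.map_congr_left fun w hw => ?_
      have hwv : w ≠ v := fun h => hv (h ▸ hw)
      simp [profile, mask_cons, H.adj_comm v, hwv]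

/-- The mask of the vertices in the domain `dom` that are adjacent to the vertices of profiles `f`
in the way prescribed by `r`. -/
noncomputable def candidates (dom : ℕ) (r : List Bool) : List (ℕ × ℕ) → ℕ :=
  fold (fun b ih f => List.rec (motive := fun _ => ℕ) dom
      (fun p f _ => Nat.land (Bool.rec p.2 p.1 b) (ih f)) f) (fun _ => dom) r

lemma testBit_of_testBit_candidates {dom i : ℕ} {r : List Bool} {f : List (ℕ × ℕ)}
    (h : (candidates dom r f).testBit i) {j : ℕ} (hr : j < r.length) (hf : j < f.length) :
    (if r[j] then f[j].1 else f[j].2).testBit i := by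
  induction r generalizing f j with
  | nil => exact absurd hr (Nat.not_lt_zero j)
  | cons b r ih =>
    cases f with
    | nil => exact absurd hf (Nat.not_lt_zero j)
    | cons p f =>
      have hcons : candidates dom (b :: r) (p :: f) =
          (if b then p.1 else p.2) &&& candidates dom r f := by cases b <;> rfl
      rw [hcons, Nat.testBit_land, Bool.and_eq_true] at h
      cases j with
      | zero => exact h.1
      | succ j => exact ih h.2 (Nat.lt_of_succ_lt_succ hr) (Nat.lt_of_succ_lt_succ hf)

/-- Whether `t` holds for some entry of a list at a position in the set with mask `c`. -/
noncomputable def anyCandidate (t : α → Bool) : List α → ℕ → Bool :=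
  fold (fun p ih c => Bool.rec (ih (Nat.div c 2)) (Bool.rec (ih (Nat.div c 2)) true (t p))
    (Nat.beq (Nat.land c 1) 1)) fun _ => false

lemma exists_of_anyCandidate {t : α → Bool} {S : List α} {c : ℕ} (h : anyCandidate t S c) :
    ∃ i, ∃ hi : i < S.length, c.testBit i ∧ t S[i] := by
  induction S generalizing c with
  | nil => exact absurd h Bool.false_ne_true
  | cons p S ih =>
    have hcons : anyCandidate t (p :: S) c =
        ((c.testBit 0 && t p) || anyCandidate t S (c / 2)) := by
      have hbit : Nat.beq (Nat.land c 1) 1 = c.testBit 0 := by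
        rw [Bool.eq_iff_iff, Nat.beq_eq, Nat.testBit_zero, decide_eq_true_eq]
        exact Eq.congr (Nat.and_one_is_mod c) rfl
      change (Bool.rec (anyCandidate t S (c / 2)) (Bool.rec (anyCandidate t S (c / 2)) true (t p))
        (Nat.beq (Nat.land c 1) 1) : Bool) = _
      rw [hbit]
      cases c.testBit 0 <;> cases t p <;> rfl
    rw [hcons, Bool.or_eq_true, Bool.and_eq_true] at h
    obtain h | h := h
    · exact ⟨0, Nat.succ_pos _, h⟩
    · obtain ⟨i, hi, hc, ht⟩ := ih h
      exact ⟨i + 1, Nat.succ_lt_succ hi, by rwa [Nat.testBit_succ], ht⟩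

/-- Whether the graph whose code has the rows `r.1` for `r ∈ R` can be embedded in the graph of
profiles `S`, with the vertex of `r` mapped into the set of mask `r.2`, so that the list of the
profiles of the images satisfies `k`. The vertices are embedded from the last to the first. -/
noncomputable def existsEmbedding (S : List (ℕ × ℕ)) :
    List (List Bool × ℕ) → (List (ℕ × ℕ) → Bool) → Bool :=
  fold (fun r ih k => ih fun f => anyCandidate (fun p => k (p :: f)) S (candidates r.2 r.1 f))
    fun k => k []

lemma codeOf_cons_eq_of_testBit_candidates [DecidableEq W] {L L' : List W} {P : List V}
    (h : codeOf H L' = codeOf G P) {v : V} {dom i : ℕ} (hi : i < L.length)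
    (hc : (candidates dom (P.map fun w => G.Adj v w) (L'.map (profile H L))).testBit i) :
    codeOf H (L[i] :: L') = codeOf G (v :: P) ∧ L[i] ∉ L' := by
  have hlen : L'.length = P.length := by rw [← length_codeOf (G := H), h, length_codeOf]
  have hj (j : ℕ) (hj : j < L'.length) (hj' : j < P.length) :
      (H.Adj L[i] L'[j] ↔ G.Adj v P[j]) ∧ L[i] ≠ L'[j] := by
    have := testBit_of_testBit_candidates hc (j := j) (by simpa using hj') (by simpa using hj)
    simp only [List.getElem_map, profile, ← apply_ite mask, testBit_mask, decide_eq_true_eq] at this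
    split_ifs at this with hadj
    · have : H.Adj L'[j] L[i] := by simpa [hi] using this
      exact ⟨iff_of_true this.symm hadj, this.ne'⟩
    · have : L'[j] ≠ L[i] ∧ ¬ H.Adj L'[j] L[i] := by simpa [hi] using this
      exact ⟨iff_of_false (fun h => this.2 h.symm) hadj, this.1.symm⟩
  refine ⟨congrArg₂ _ (List.ext_getElem (by simpa using hlen) fun j h₁ h₂ => ?_) h, fun hmem => ?_⟩
  · rw [List.getElem_map, List.getElem_map, decide_eq_decide]
    exact (hj j (by simpa using h₁) (by simpa using h₂)).1
  · obtain ⟨j, hjL, hji⟩ := List.getElem_of_mem hmem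
    exact (hj j hjL (hlen ▸ hjL)).2 hji.symm

lemma exists_of_existsEmbedding [DecidableEq W] {L : List W} {P : List V}
    {R : List (List Bool × ℕ)} (hR : R.map Prod.fst = codeOf G P) {k : List (ℕ × ℕ) → Bool}
    (h : existsEmbedding (L.map (profile H L)) R k) :
    ∃ L' : List W, codeOf H L' = codeOf G P ∧ L'.Nodup ∧ k (L'.map (profile H L)) := by
  induction P generalizing R k with
  | nil =>
    rw [codeOf, List.map_eq_nil_iff] at hR
    subst hR
    exact ⟨[], rfl, List.nodup_nil, h⟩
  | cons v P ih =>
    obtain ⟨r, R, rfl, hr, hR⟩ := List.map_eq_cons_iff.1 hR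
    obtain ⟨L', hL', hnd, h⟩ := ih hR h
    obtain ⟨i, hi, hc, hk⟩ := exists_of_anyCandidate h
    rw [hr] at hc
    have hi' : i < L.length := by simpa using hi
    obtain ⟨hcode, hmem⟩ := codeOf_cons_eq_of_testBit_candidates hL' hi' hc
    exact ⟨L[i] :: L', hcode, List.nodup_cons.2 ⟨hmem, hnd⟩, by simpa using hk⟩

/-- Whether the graph of code `R` is an induced subgraph of that of code `S`. A vertex is only
mapped to vertices of at least the same degree. -/
noncomputable def Code.embeds (R S : Code) : Bool :=
  let d := S.degrees
  Nat.ble R.length S.length && existsEmbedding S.profiles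
    (R.zip (R.degrees.map fun k => mask (d.map fun e => Nat.ble k e))) fun _ => true

theorem isIndContained_of_embeds {P : List V} {L : List W}
    (h : (codeOf G P).embeds (codeOf H L)) (hP : ∀ v, v ∈ P) (hL : L.Nodup) :
    G.IsIndContained H := by
  classical
  have hembed := (Bool.and_eq_true_iff.1 h).2
  rw [profiles_codeOf hL] at hembed
  obtain ⟨L', hcode, hL', -⟩ := exists_of_existsEmbedding
    (List.map_fst_zip (by simp [degrees_codeOf, length_codeOf])) hembed
  exact isIndContained_of_codeOf_eq hcode.symm hP hL'

end Codes

section Planarity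

variable {V W X : Type*} {K : SimpleGraph W} {G : SimpleGraph V} {G' : SimpleGraph X}

lemma isMinor_of_isContained (h : K.IsContained G) : IsMinor K G := by
  obtain ⟨f⟩ := h
  refine ⟨fun x => {f x}, fun x => SimpleGraph.Connected.of_subsingleton, fun x y hxy => ?_,
    fun x y hxy => ⟨f x, rfl, f y, rfl, f.toHom.map_adj hxy⟩⟩
  exact Set.disjoint_singleton.2 (f.injective.ne hxy)

lemma IsMinor.of_isIndContained (h : IsMinor K G) (hG : G.IsIndContained G') : IsMinor K G' := by
  obtain ⟨B, hconn, hdisj, hadj⟩ := h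
  obtain ⟨f⟩ := hG
  refine ⟨fun x => f '' B x, fun x => ?_, fun x y hxy => ?_, fun x y hxy => ?_⟩
  · refine (hconn x).map (SimpleGraph.induceHom f.toHom (Set.mapsTo_image f _)) ?_
    rintro ⟨-, v, hv, rfl⟩
    exact ⟨⟨v, hv⟩, rfl⟩
  · exact (Set.disjoint_image_iff f.injective).2 (hdisj x y hxy)
  · obtain ⟨a, ha, b, hb, hab⟩ := hadj x y hxy
    exact ⟨f a, Set.mem_image_of_mem f ha, f b, Set.mem_image_of_mem f hb, f.map_adj_iff.2 hab⟩

lemma IsPlanar.false_of_three_common (hG : IsPlanar G) {l r : Fin 3 → V}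
    (hl : Function.Injective l) (hr : Function.Injective r) (h : ∀ i j, G.Adj (l i) (r j)) :
    False := by
  refine hG.2 (isMinor_of_isContained ⟨⟨⟨Sum.elim l r, ?_⟩, ?_⟩⟩)
  · rintro (i | i) (j | j) hij
    · simp at hij
    · exact h i j
    · exact (h j i).symm
    · simp at hij
  · exact hl.sumElim hr fun i j hij => G.irrefl (hij ▸ h i j)

/-- A graph on `{0, …, order - 1}` given by its edges, with a list of vertices for each vertex of a
possible minor. -/
structure MinorModel (W : Type*) where
  order : ℕ
  edges : List (Fin order × Fin order)
  branch : W → List (Fin order)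

/-- The graph of a minor model. -/
def MinorModel.graph (M : MinorModel W) : SimpleGraph (Fin M.order) := ofEdges M.order M.edges

instance (M : MinorModel W) : DecidableRel M.graph.Adj :=
  inferInstanceAs (DecidableRel (ofEdges _ _).Adj)

/-- The code of the graph of a minor model. -/
def MinorModel.code (M : MinorModel W) : Code := codeOf M.graph (List.finRange M.order).reverse

/-- The lists of vertices of a minor model of `K` are disjoint paths, joined by edges as required
by `K`. -/
def MinorModel.IsValid (M : MinorModel W) (K : SimpleGraph W) : Prop :=
  (∀ x, M.branch x ≠ [] ∧ (M.branch x).IsChain M.graph.Adj) ∧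
    (∀ x y, x ≠ y → ∀ a ∈ M.branch x, a ∉ M.branch y) ∧
    ∀ x y, K.Adj x y → ∃ a ∈ M.branch x, ∃ b ∈ M.branch y, M.graph.Adj a b

set_option synthInstance.maxSize 400 in
instance [Fintype W] [DecidableEq W] [DecidableRel K.Adj] (M : MinorModel W) :
    Decidable (M.IsValid K) := inferInstanceAs (Decidable (_ ∧ _ ∧ _))

lemma MinorModel.IsValid.isMinor {M : MinorModel W} (h : M.IsValid K) : IsMinor K M.graph := by
  obtain ⟨hpath, hdisj, hadj⟩ := h
  refine ⟨fun x => {a | a ∈ M.branch x}, fun x => ?_,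
    fun x y hxy => Set.disjoint_left.2 (hdisj x y hxy), hadj⟩
  have := (SimpleGraph.Walk.ofSupport _ (hpath x).1 (hpath x).2).connected_induce_support
  rwa [SimpleGraph.Walk.support_ofSupport] at this

instance : DecidableRel (completeBipartiteGraph (Fin 3) (Fin 3)).Adj := fun a b =>
  inferInstanceAs (Decidable (a.isLeft ∧ b.isRight ∨ a.isRight ∧ b.isLeft))

/-- Models of `K₃,₃` that occur in the finite search. -/
def k33Models : List (MinorModel (Fin 3 ⊕ Fin 3)) :=
  [⟨9,
    [(0, 1), (0, 2), (0, 7), (0, 8), (1, 3), (1, 5), (1, 6), (2, 4), (2, 6), (3, 4), (3, 7),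
     (4, 5), (5, 8)],
    Sum.elim ![[0], [1], [4]] ![[6, 2], [7, 3], [8, 5]]⟩,
   ⟨9,
    [(0, 1), (0, 2), (0, 6), (0, 7), (0, 8), (1, 3), (1, 4), (1, 5), (2, 3), (2, 4), (2, 5),
     (3, 6), (4, 7), (5, 8)],
    Sum.elim ![[0], [1], [2]] ![[6, 3], [7, 4], [8, 5]]⟩,
   ⟨7,
    [(0, 1), (0, 2), (0, 4), (1, 3), (1, 6), (2, 3), (2, 6), (3, 4), (4, 5), (5, 6)],
    Sum.elim ![[6], [3], [0]] ![[2], [1], [5, 4]]⟩,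
   ⟨8,
    [(0, 1), (0, 4), (0, 5), (1, 6), (1, 7), (2, 4), (2, 5), (2, 7), (3, 4), (3, 6), (5, 6)],
    Sum.elim ![[1], [5], [4]] ![[0], [7, 2], [3, 6]]⟩,
   ⟨8,
    [(0, 1), (0, 2), (0, 5), (0, 6), (1, 3), (1, 4), (1, 7), (2, 3), (2, 4), (3, 5), (4, 6),
     (5, 7), (6, 7)],
    Sum.elim ![[0], [3], [4]] ![[1], [2], [6, 7, 5]]⟩,
   ⟨9,
    [(0, 1), (0, 4), (0, 6), (0, 8), (1, 2), (1, 5), (2, 3), (2, 4), (3, 5), (3, 7), (3, 8),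
     (4, 7), (5, 6), (6, 7)],
    Sum.elim ![[0], [2], [5]] ![[1], [8, 3], [6, 7, 4]]⟩,
   ⟨9,
    [(0, 1), (0, 2), (0, 7), (1, 5), (1, 6), (2, 3), (2, 8), (3, 4), (3, 6), (4, 5), (4, 7),
     (5, 8)],
    Sum.elim ![[0], [3], [5]] ![[6, 1], [7, 4], [8, 2]]⟩,
   ⟨6,
    [(0, 1), (0, 4), (0, 5), (1, 2), (1, 3), (2, 4), (2, 5), (3, 4), (3, 5)],
    Sum.elim ![[2], [0], [3]] ![[5], [4], [1]]⟩,
   ⟨8,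
    [(0, 1), (0, 3), (0, 6), (1, 4), (1, 5), (2, 3), (2, 5), (2, 6), (3, 7), (4, 6), (4, 7),
     (5, 7)],
    Sum.elim ![[6], [1], [3]] ![[0], [7, 4], [5, 2]]⟩]

/-- Models of `K₅` that occur in the finite search. -/
def k5Models : List (MinorModel (Fin 5)) :=
  [⟨9,
    [(0, 1), (0, 3), (0, 5), (0, 6), (1, 2), (1, 4), (1, 8), (2, 3), (2, 5), (2, 7), (3, 4),
     (3, 8), (4, 6), (4, 7)],
    ![[0], [1], [5, 2], [8, 3], [7, 4, 6]]⟩,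
   ⟨10,
    [(0, 1), (0, 4), (0, 5), (0, 6), (1, 2), (1, 8), (1, 9), (2, 3), (2, 5), (2, 7), (3, 4),
     (3, 6), (3, 8), (4, 7), (4, 9)],
    ![[0], [1], [5, 2], [8, 3, 6], [9, 4, 7]]⟩]

lemma isValid_of_mem_k33Models :
    ∀ M ∈ k33Models, M.IsValid (completeBipartiteGraph (Fin 3) (Fin 3)) := by decide +kernel

lemma isValid_of_mem_k5Models : ∀ M ∈ k5Models, M.IsValid (⊤ : SimpleGraph (Fin 5)) := by
  decide +kernel

/-- The codes of the nonplanar graphs that occur in the finite search. -/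
def nonplanarCodes : List Code :=
  k33Models.map MinorModel.code ++ k5Models.map MinorModel.code

variable [DecidableRel G.Adj]

lemma MinorModel.IsValid.isMinor_of_embeds {M : MinorModel W} (hM : M.IsValid K) {L : List V}
    (hL : L.Nodup) (h : M.code.embeds (codeOf G L)) : IsMinor K G :=
  hM.isMinor.of_isIndContained (isIndContained_of_embeds h (by simp) hL)

lemma not_isPlanar_of_embeds {S : Code} (hS : S ∈ nonplanarCodes) {L : List V} (hL : L.Nodup)
    (h : S.embeds (codeOf G L)) : ¬ IsPlanar G := by
  rintro ⟨hK5, hK33⟩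
  obtain hS | hS := List.mem_append.1 hS
  · obtain ⟨M, hM, rfl⟩ := List.mem_map.1 hS
    exact hK33 ((isValid_of_mem_k33Models M hM).isMinor_of_embeds hL h)
  · obtain ⟨M, hM, rfl⟩ := List.mem_map.1 hS
    exact hK5 ((isValid_of_mem_k5Models M hM).isMinor_of_embeds hL h)

end Planarity

section Search

/-- The graph is an induced subgraph of one of the graphs in the list of the theorem. -/
def IsListed {V : Type*} (G : SimpleGraph V) : Prop :=
  (∃ s : ℕ, 3 ≤ s ∧ G.IsIndContained (F1 s)) ∨ G.IsIndContained H1 ∨ G.IsIndContained H2 ∨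
    G.IsIndContained H3 ∨ G.IsIndContained H4 ∨ G.IsIndContained H5 ∨ G.IsIndContained H6 ∨
    G.IsIndContained H7 ∨ G.IsIndContained H8 ∨ G.IsIndContained H9 ∨ G.IsIndContained H10 ∨
    G.IsIndContained H11 ∨ G.IsIndContained H12 ∨ G.IsIndContained H13

/-- The codes of the listed graphs. Among the graphs `F1 s`, the search only needs `F1 7`. -/
def targetCodes : List Code :=
  [codeOf (F1 7) ([.v1, .v2] ++ (List.finRange 7).map .u ++ (List.finRange 7).map .w),
    codeOf H1 (List.finRange _), codeOf H2 (List.finRange _), codeOf H3 (List.finRange _),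
    codeOf H4 (List.finRange _), codeOf H5 (List.finRange _), codeOf H6 (List.finRange _),
    codeOf H7 (List.finRange _), codeOf H8 (List.finRange _), codeOf H9 (List.finRange _),
    codeOf H10 (List.finRange _), codeOf H11 (List.finRange _), codeOf H12 (List.finRange _),
    codeOf H13 (List.finRange _)]

/-- A list of vertices outside a star. Each vertex is given by its adjacencies with the leaves of
the star, called its trace, and with the vertices that follow it in the list. -/
abbrev OuterCode := List (List Bool × List Bool)

/-- The rows of `d` leaves in the code of a graph that consists of a star with these leaves and of
vertices with given traces. The centre of the star comes last. -/
def leafRows : ℕ → List (List Bool) → Code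
  | 0, _ => []
  | d + 1, T => (List.replicate d false ++ T.map (·.headD false) ++ [true]) ::
      leafRows d (T.map List.tail)

/-- The code of a graph that consists of a star with `d` leaves and of the vertices of `X`. -/
def starCode (d : ℕ) (X : OuterCode) : Code :=
  leafRows d (X.map Prod.fst) ++ (X.map (fun p => p.2 ++ [false]) ++ [[]])

/-- The number of leaves common to two traces. -/
def commonLeaves (s t : List Bool) : ℕ := (List.zipWith and s t).count true

/-- The entry of `residualGram` for two vertices with traces `s` and `t`, where `m + 1` is the
degree of the centre and `e` is the entry of `1 - A`. -/
def gramEntry (m : ℕ) (s t : List Bool) (e : ℤ) : ℤ :=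
  m * e + commonLeaves s s * commonLeaves t t - m * commonLeaves s t

/-- Minus the entry of the adjacency matrix. -/
def negOfBool (b : Bool) : ℤ := bif b then -1 else 0

/-- Whether a vertex of trace `s` with adjacencies `b :: bs` to the vertices of `p :: X` neither
forms a triangle with the vertex of `p` and a leaf, nor makes a principal minor of order two or
three of the residual Gram matrix negative that involves both vertices. -/
def admissible (m : ℕ) (s : List Bool) (p : List Bool × List Bool) (X : OuterCode) (b : Bool)
    (bs : List Bool) : Bool :=
  let ss := gramEntry m s s 1
  let tt := gramEntry m p.1 p.1 1
  let st := gramEntry m s p.1 (negOfBool b)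
  !(b && Nat.blt 0 (commonLeaves s p.1)) && decide (st * st ≤ ss * tt) &&
    (bs.zip (p.2.zip (X.map Prod.fst))).all fun (a, c, u) =>
      let uu := gramEntry m u u 1
      let su := gramEntry m s u (negOfBool a)
      let tu := gramEntry m p.1 u (negOfBool c)
      decide (0 ≤ ss * tt * uu + 2 * st * su * tu - ss * tu * tu - tt * su * su - uu * st * st)

/-- The possible lists of adjacencies of a new vertex of trace `s` to the vertices of `X`. -/
def extensions (m : ℕ) (s : List Bool) : OuterCode → List (List Bool)
  | [] => [[]]
  | p :: X => (extensions m s X).flatMap fun bs =>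
      ([false, true].filter fun b => admissible m s p X b bs).map (· :: bs)

/-- All lists of `d` truth values. -/
def boolLists : ℕ → List (List Bool)
  | 0 => [[]]
  | d + 1 => (boolLists d).flatMap fun s => [false :: s, true :: s]

/-- Whether a vertex with `k` neighbours among `m + 1` leaves has nonnegative residual norm. -/
def sizeOK (m k : ℕ) : Bool := Nat.ble (m * k) (m + k * k)

/-- The nonempty traces of size at most `k` on `d` leaves that have nonnegative residual norm, those
of largest size first. -/
def availableTraces (d k : ℕ) : List (List Bool) :=
  ((List.range k).reverse.filter fun j => sizeOK (d - 1) (j + 1)).flatMap fun j =>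
    (boolLists d).filter fun s => commonLeaves s s == j + 1

/-- Whether the graph with the vertices of `X` is either an induced subgraph of a listed graph all
of whose extensions are so, as checked by `expand`, or is nonplanar, or has too large a degree. -/
noncomputable def checkState (d : ℕ) (expand : OuterCode → List (List Bool) → Bool)
    (X : OuterCode) (av : List (List Bool)) : Bool :=
  let R := starCode d X
  bif R.degrees.all (Nat.ble · d) then
    bif targetCodes.any (R.embeds ·) then expand X av else nonplanarCodes.any (·.embeds R)
  else true

/-- Whether all extensions of `X` by vertices with traces in `av` or with empty trace are
induced subgraphs of listed graphs, when fewer than `n` steps are enough to see it. -/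
noncomputable def checkExtensions (d : ℕ) : ℕ → OuterCode → List (List Bool) → Bool
  | 0, _, _ => false
  | n + 1, X, [] =>
      ((extensions (d - 1) (List.replicate d false) X).filter (·.any id)).all fun bs =>
        checkState d (checkExtensions d n) ((List.replicate d false, bs) :: X) []
  | n + 1, X, s :: av => checkExtensions d n X av && (extensions (d - 1) s X).all fun bs =>
      checkState d (checkExtensions d n) ((s, bs) :: X) (s :: av)

/-- Whether all graphs of maximum degree `d` with the required properties are induced subgraphs of
listed graphs. The first vertex outside a star of degree `d` has a trace of largest size. -/
noncomputable def checkDegree (d : ℕ) : Bool :=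
  checkState d (checkExtensions d 50) [] [] &&
    (List.range d).all fun k => !sizeOK (d - 1) (k + 1) || checkState d (checkExtensions d 50)
      [(List.replicate (k + 1) true ++ List.replicate (d - (k + 1)) false, [])]
      (availableTraces d (k + 1))

end Search

section SearchSoundness

variable {V : Type*} {G : SimpleGraph V}

/-- Distinct vertices that form a star of centre `c` with all its neighbours `leaves`, together with
some vertices `xs` outside the star. -/
structure IsStarList (G : SimpleGraph V) (c : V) (leaves xs : List V) : Prop where
  nodup_leaves : leaves.Nodup
  mem_leaves {v : V} : v ∈ leaves ↔ G.Adj c v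
  nodup_outer : xs.Nodup
  off_star {x : V} : x ∈ xs → x ≠ c ∧ ¬ G.Adj c x

namespace IsStarList

variable {c : V} {leaves xs : List V}

lemma nodup (h : IsStarList G c leaves xs) : (leaves ++ (xs ++ [c])).Nodup := by
  rw [List.nodup_append', List.nodup_append']
  refine ⟨h.nodup_leaves, ⟨h.nodup_outer, List.nodup_singleton c, fun x hx hc => ?_⟩,
    fun v hv hv' => ?_⟩
  · exact (h.off_star hx).1 (List.mem_singleton.1 hc)
  · obtain hx | hc := List.mem_append.1 hv'
    · exact (h.off_star hx).2 (h.mem_leaves.1 hv)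
    · exact G.irrefl (List.mem_singleton.1 hc ▸ h.mem_leaves.1 hv)

lemma cons (h : IsStarList G c leaves xs) {x : V} (hx : x ≠ c ∧ ¬ G.Adj c x) (hxs : x ∉ xs) :
    IsStarList G c leaves (x :: xs) where
  nodup_leaves := h.nodup_leaves
  mem_leaves := h.mem_leaves
  nodup_outer := List.nodup_cons.2 ⟨hxs, h.nodup_outer⟩
  off_star := by
    rintro y (_ | ⟨_, hy⟩)
    · exact hx
    · exact h.off_star hy

lemma of_cons {x : V} (h : IsStarList G c leaves (x :: xs)) : IsStarList G c leaves xs where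
  nodup_leaves := h.nodup_leaves
  mem_leaves := h.mem_leaves
  nodup_outer := (List.nodup_cons.1 h.nodup_outer).2
  off_star hy := h.off_star (List.mem_cons_of_mem x hy)

end IsStarList

variable [DecidableRel G.Adj]

/-- The trace of a vertex on a list of leaves, see `OuterCode`. -/
def trace (G : SimpleGraph V) [DecidableRel G.Adj] (leaves : List V) (x : V) : List Bool :=
  leaves.map fun v => decide (G.Adj x v)

/-- The `OuterCode` of a list of vertices. -/
def outerCode (G : SimpleGraph V) [DecidableRel G.Adj] (leaves : List V) : List V → OuterCode
  | [] => []
  | x :: xs => (trace G leaves x, xs.map fun y => decide (G.Adj x y)) :: outerCode G leaves xs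

lemma map_fst_outerCode (leaves xs : List V) :
    (outerCode G leaves xs).map Prod.fst = xs.map (trace G leaves) := by
  induction xs with
  | nil => rfl
  | cons x xs ih => exact congrArg (_ :: ·) ih

lemma trace_eq_replicate_false_iff {leaves : List V} {x : V} :
    trace G leaves x = List.replicate leaves.length false ↔ ∀ v ∈ leaves, ¬ G.Adj x v := by
  simp [trace, List.map_eq_replicate_iff]

lemma commonLeaves_trace (leaves : List V) (x y : V) :
    commonLeaves (trace G leaves x) (trace G leaves y) =
      leaves.countP fun v => G.Adj x v ∧ G.Adj y v := by
  rw [commonLeaves, trace, trace, List.zipWith_map, List.zipWith_self, List.count, List.countP_map]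
  exact List.countP_congr fun v _ => by simp

lemma trace_mem_boolLists (leaves : List V) (x : V) :
    trace G leaves x ∈ boolLists leaves.length := by
  induction leaves with
  | nil => exact List.mem_singleton_self _
  | cons v leaves ih =>
    refine List.mem_flatMap.2 ⟨_, ih, ?_⟩
    by_cases h : G.Adj x v <;> simp [trace, h]

lemma codeOf_leaves_append {leaves : List V} (hl : ∀ v ∈ leaves, ∀ w ∈ leaves, ¬ G.Adj v w)
    {c : V} (hc : ∀ v ∈ leaves, G.Adj c v) (xs : List V) :
    codeOf G (leaves ++ (xs ++ [c])) =
      leafRows leaves.length (xs.map (trace G leaves)) ++ codeOf G (xs ++ [c]) := by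
  induction leaves with
  | nil => rfl
  | cons v leaves ih =>
    rw [List.forall_mem_cons] at hc
    have hv : leaves.map (fun w => decide (G.Adj v w)) = List.replicate leaves.length false := by
      simpa [List.map_eq_replicate_iff] using
        fun w hw => hl v List.mem_cons_self w (List.mem_cons_of_mem v hw)
    rw [List.cons_append, codeOf, ih (fun w hw w' hw' =>
      hl w (List.mem_cons_of_mem v hw) w' (List.mem_cons_of_mem v hw')) hc.2, List.map_append, hv]
    simp only [List.map_append, List.map_cons, List.map_nil, leafRows, List.length_cons,
      List.map_map, List.cons_append, ← G.adj_comm c, hc.1, decide_true, List.append_assoc]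
    simp only [Function.comp_def, trace, List.map_cons, List.headD_cons, List.tail_cons,
      G.adj_comm v]
    rfl

lemma codeOf_outer_append {c : V} {xs : List V} (hc : ∀ x ∈ xs, ¬ G.Adj c x) (leaves : List V) :
    codeOf G (xs ++ [c]) =
      (outerCode G leaves xs).map (fun p => p.2 ++ [false]) ++ [[]] := by
  induction xs with
  | nil => rfl
  | cons x xs ih =>
    rw [List.forall_mem_cons] at hc
    rw [List.cons_append, codeOf, ih hc.2]
    simp [outerCode, G.adj_comm x, hc.1]

namespace IsStarList

variable {c : V} {leaves xs : List V}

lemma starCode_eq (h : IsStarList G c leaves xs) (htri : G.CliqueFree 3) :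
    starCode leaves.length (outerCode G leaves xs) = codeOf G (leaves ++ (xs ++ [c])) := by
  rw [starCode, map_fst_outerCode, codeOf_leaves_append, codeOf_outer_append]
  · exact fun x hx => (h.off_star hx).2
  · exact fun v hv w hw => not_adj_of_cliqueFree_three htri (h.mem_leaves.1 hv) (h.mem_leaves.1 hw)
  · exact fun v hv => h.mem_leaves.1 hv

variable [Fintype V]

lemma length_leaves (h : IsStarList G c leaves xs) : leaves.length = G.degree c := by
  classical
  rw [← List.toFinset_card_of_nodup h.nodup_leaves, ← SimpleGraph.card_neighborFinset_eq_degree]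
  congr 1
  ext v
  simp [h.mem_leaves]

lemma commonLeaves_eq_overlap (h : IsStarList G c leaves xs) (x y : V) :
    commonLeaves (trace G leaves x) (trace G leaves y) = overlap G c x y := by
  classical
  rw [commonLeaves_trace, List.countP_eq_length_filter,
    ← List.toFinset_card_of_nodup (h.nodup_leaves.filter _), overlap]
  congr 1
  ext v
  simp [h.mem_leaves]

lemma gramEntry_self [DecidableEq V] (h : IsStarList G c leaves xs) (hc : 0 < G.degree c) (x : V) :
    gramEntry (leaves.length - 1) (trace G leaves x) (trace G leaves x) 1 =
      residualGram G c x x := by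
  simp only [gramEntry, residualGram, Matrix.of_apply, h.commonLeaves_eq_overlap, h.length_leaves,
    G.irrefl, if_true, if_false, Nat.cast_pred hc]
  ring

lemma gramEntry_of_ne [DecidableEq V] (h : IsStarList G c leaves xs) (hc : 0 < G.degree c) {x y : V}
    (hxy : x ≠ y) :
    gramEntry (leaves.length - 1) (trace G leaves x) (trace G leaves y)
      (negOfBool (G.Adj x y)) = residualGram G c x y := by
  simp only [gramEntry, residualGram, Matrix.of_apply, h.commonLeaves_eq_overlap, h.length_leaves,
    if_neg hxy, Nat.cast_pred hc, negOfBool, Bool.cond_decide]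
  split_ifs <;> ring

lemma sizeOK_overlap (h : IsStarList G c leaves xs) (hG : HasSmallLambda2 G)
    (htri : G.CliqueFree 3) (hc : 0 < G.degree c) {x : V} (hx : x ≠ c ∧ ¬ G.Adj c x) :
    sizeOK (leaves.length - 1) (overlap G c x x) := by
  classical
  have h0 := hG.residualGram_self_nonneg htri hc hx
  rw [residualGram_self, ← Nat.cast_pred hc, ← h.length_leaves] at h0
  rw [sizeOK, Nat.ble_eq]
  zify
  linarith

lemma admissible_cons {x y : V} (h : IsStarList G c leaves (y :: xs)) (hG : HasSmallLambda2 G)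
    (htri : G.CliqueFree 3) (hc : 0 < G.degree c) (hx : x ≠ c ∧ ¬ G.Adj c x) (hxs : x ∉ y :: xs) :
    admissible (leaves.length - 1) (trace G leaves x)
      (trace G leaves y, xs.map fun z => decide (G.Adj y z)) (outerCode G leaves xs)
      (G.Adj x y) (xs.map fun z => decide (G.Adj x z)) := by
  classical
  have hy := h.off_star List.mem_cons_self
  have hxy : x ≠ y := fun e => hxs (e ▸ List.mem_cons_self)
  rw [admissible, map_fst_outerCode, List.zip_map', List.zip_map', List.all_map, Bool.and_eq_true,
    Bool.and_eq_true, decide_eq_true_eq, List.all_eq_true, h.gramEntry_self hc,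
    h.gramEntry_self hc, h.gramEntry_of_ne hc hxy]
  refine ⟨⟨?_, hG.residualGram_sq_le htri hc hx hy⟩, fun z hz => decide_eq_true ?_⟩
  · rw [Bool.not_eq_true', Bool.and_eq_false_imp, decide_eq_true_eq]
    intro hadj
    rw [commonLeaves_trace, List.countP_eq_zero.2 fun v _ hv => ?_]
    · rfl
    · obtain ⟨hxv, hyv⟩ := of_decide_eq_true hv
      exact not_adj_of_cliqueFree_three htri hxv.symm hyv.symm hadj
  · have hxz : x ≠ z := fun e => hxs (e ▸ List.mem_cons_of_mem y hz)
    have hyz : y ≠ z := fun e => (List.nodup_cons.1 h.nodup_outer).1 (e ▸ hz)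
    simp only [h.gramEntry_self hc, h.gramEntry_of_ne hc hxz, h.gramEntry_of_ne hc hyz]
    exact hG.residualGram_det_three_nonneg htri hc hx hy (h.of_cons.off_star hz)

lemma mem_extensions (h : IsStarList G c leaves xs) (hG : HasSmallLambda2 G)
    (htri : G.CliqueFree 3) (hc : 0 < G.degree c) {x : V} (hx : x ≠ c ∧ ¬ G.Adj c x)
    (hxs : x ∉ xs) :
    xs.map (fun y => decide (G.Adj x y)) ∈
      extensions (leaves.length - 1) (trace G leaves x) (outerCode G leaves xs) := by
  induction xs with
  | nil => exact List.mem_singleton_self _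
  | cons y xs ih =>
    refine List.mem_flatMap.2 ⟨_, ih h.of_cons fun hmem => hxs (List.mem_cons_of_mem y hmem), ?_⟩
    refine List.mem_map.2 ⟨_, List.mem_filter.2 ⟨?_, h.admissible_cons hG htri hc hx hxs⟩, rfl⟩
    cases decide (G.Adj x y) <;> simp

end IsStarList

lemma isListed_of_embeds {P : List V} (hP : ∀ v, v ∈ P) {S : Code} (hS : S ∈ targetCodes)
    (h : (codeOf G P).embeds S) : IsListed G := by
  have hF1 : (([.v1, .v2] ++ (List.finRange 7).map .u ++ (List.finRange 7).map .w :
      List (F1Vertex 7))).Nodup := by decide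
  have hfin (n : ℕ) := List.nodup_finRange n
  have key {W : Type} {H : SimpleGraph W} [DecidableRel H.Adj] {L : List W} (hL : L.Nodup)
      (hS : S = codeOf H L) : G.IsIndContained H := isIndContained_of_embeds (hS ▸ h) hP hL
  simp only [targetCodes, List.mem_cons, List.not_mem_nil, or_false] at hS
  exact hS.imp (fun e => ⟨7, by norm_num, key hF1 e⟩) <|
    .imp (key (hfin _)) <| .imp (key (hfin _)) <| .imp (key (hfin _)) <| .imp (key (hfin _)) <|
    .imp (key (hfin _)) <| .imp (key (hfin _)) <| .imp (key (hfin _)) <| .imp (key (hfin _)) <|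
    .imp (key (hfin _)) <| .imp (key (hfin _)) <| .imp (key (hfin _)) <|
    .imp (key (hfin _)) (key (hfin _))

end SearchSoundness

section SearchCorrectness

variable {V : Type*} {G : SimpleGraph V}

lemma exists_adj_of_connected (hconn : G.Connected) {p : V → Prop} {v w : V} (hv : p v)
    (hw : ¬ p w) : ∃ x y, p x ∧ ¬ p y ∧ G.Adj x y := by
  obtain ⟨d, -, hd⟩ := (hconn v w).some.exists_boundary_dart {v | p v} hv hw
  exact ⟨d.fst, d.snd, hd.1, hd.2, d.adj⟩

lemma exists_isStarList_nil [Finite V] (G : SimpleGraph V) (c : V) :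
    ∃ leaves, IsStarList G c leaves [] := by
  classical
  have := Fintype.ofFinite V
  exact ⟨(G.neighborFinset c).toList, Finset.nodup_toList _, by simp, List.nodup_nil, by simp⟩

variable [DecidableRel G.Adj] {c : V} {leaves xs : List V}

/-- The traces of the vertices outside the star and the list `xs` belong to `av` or are empty. -/
def AreAvailable (G : SimpleGraph V) [DecidableRel G.Adj] (c : V) (leaves xs : List V)
    (av : List (List Bool)) : Prop :=
  ∀ x, x ≠ c ∧ ¬ G.Adj c x → x ∉ xs →
    trace G leaves x ∈ av ∨ trace G leaves x = List.replicate leaves.length false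

lemma IsStarList.exists_adj_of_empty_traces (h : IsStarList G c leaves xs) (hconn : G.Connected)
    (hempty : AreAvailable G c leaves xs []) (hcover : ¬ ∀ v, v ∈ leaves ++ (xs ++ [c])) :
    ∃ x, (x ≠ c ∧ ¬ G.Adj c x) ∧ x ∉ xs ∧ trace G leaves x = List.replicate leaves.length false ∧
      ∃ y ∈ xs, G.Adj x y := by
  push Not at hcover
  obtain ⟨w, hw⟩ := hcover
  obtain ⟨y, x, hy, hx, hadj⟩ := exists_adj_of_connected hconn
    (p := fun v => v ∈ leaves ++ (xs ++ [c])) (v := c) (by simp) hw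
  simp only [List.mem_append, List.mem_singleton, h.mem_leaves, not_or] at hy hx
  obtain ⟨hcx, hxs, hne⟩ := hx
  have htrace := (hempty x ⟨hne, hcx⟩ hxs).resolve_left List.not_mem_nil
  refine ⟨x, ⟨hne, hcx⟩, hxs, htrace, y, ?_, hadj.symm⟩
  obtain hcy | hy | rfl := hy
  · exact absurd hadj.symm (trace_eq_replicate_false_iff.1 htrace y (h.mem_leaves.2 hcy))
  · exact hy
  · exact absurd hadj hcx

variable [Fintype V]

lemma exists_isStarList_singleton {x : V} (hx : x ≠ c ∧ ¬ G.Adj c x) :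
    ∃ leaves, IsStarList G c leaves [x] ∧ trace G leaves x =
      List.replicate (overlap G c x x) true ++
        List.replicate (leaves.length - overlap G c x x) false := by
  classical
  let common := Finset.univ.filter fun v => G.Adj c v ∧ G.Adj x v ∧ G.Adj x v
  let others := Finset.univ.filter fun v => G.Adj c v ∧ ¬ G.Adj x v
  refine ⟨common.toList ++ others.toList, ⟨?_, ?_, List.nodup_singleton x, ?_⟩, ?_⟩
  · refine common.nodup_toList.append others.nodup_toList fun v hv hv' => ?_
    simp only [Finset.mem_toList, common, others, Finset.mem_filter] at hv hv'
    exact hv'.2.2 hv.2.2.1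
  · intro v
    simp only [List.mem_append, Finset.mem_toList, common, others, Finset.mem_filter,
      Finset.mem_univ, true_and, and_self, ← and_or_left, em, and_true]
  · rintro y hy
    rwa [List.mem_singleton.1 hy]
  · rw [trace, List.map_append, List.length_append, Finset.length_toList, Finset.length_toList]
    rw [show common.card = overlap G c x x from rfl, Nat.add_sub_cancel_left]
    congr 1 <;> simp [List.eq_replicate_iff, common, others, overlap]

namespace IsStarList

lemma trace_eq_replicate_false (h : IsStarList G c leaves xs) {x : V}
    (hx : overlap G c x x = 0) : trace G leaves x = List.replicate leaves.length false := by
  rw [trace_eq_replicate_false_iff]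
  rw [← h.commonLeaves_eq_overlap, commonLeaves_trace, List.countP_eq_zero] at hx
  simpa using hx

lemma trace_mem_availableTraces (h : IsStarList G c leaves xs) (hG : HasSmallLambda2 G)
    (htri : G.CliqueFree 3) (hc : 0 < G.degree c) {x : V} (hx : x ≠ c ∧ ¬ G.Adj c x) {k : ℕ}
    (hpos : 0 < overlap G c x x) (hle : overlap G c x x ≤ k) :
    trace G leaves x ∈ availableTraces leaves.length k := by
  have hpred : overlap G c x x - 1 + 1 = overlap G c x x := Nat.sub_add_cancel hpos
  refine List.mem_flatMap.2 ⟨overlap G c x x - 1, List.mem_filter.2 ⟨?_, ?_⟩,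
    List.mem_filter.2 ⟨trace_mem_boolLists leaves x, ?_⟩⟩
  · rw [List.mem_reverse, List.mem_range]
    omega
  · rw [hpred]
    exact h.sizeOK_overlap hG htri hc hx
  · rw [hpred, beq_iff_eq, h.commonLeaves_eq_overlap]

lemma of_checkState (h : IsStarList G c leaves xs) (htri : G.CliqueFree 3) (hpl : IsPlanar G)
    (hmax : ∀ v, G.degree v ≤ leaves.length) {expand : OuterCode → List (List Bool) → Bool}
    {av : List (List Bool)}
    (hcheck : checkState leaves.length expand (outerCode G leaves xs) av) :
    (∃ S ∈ targetCodes, (codeOf G (leaves ++ (xs ++ [c]))).embeds S) ∧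
      expand (outerCode G leaves xs) av := by
  have hdeg : (codeOf G (leaves ++ (xs ++ [c]))).degrees.all (Nat.ble · leaves.length) :=
    List.all_eq_true.2 fun d hd => Nat.ble_eq ▸ (le_of_mem_degrees_codeOf h.nodup hmax hd)
  rw [checkState, h.starCode_eq htri, hdeg, cond_true, Bool.cond_eq_ite] at hcheck
  split_ifs at hcheck with htarget
  · exact ⟨List.any_eq_true.1 htarget, hcheck⟩
  · obtain ⟨S, hS, hembeds⟩ := List.any_eq_true.1 hcheck
    exact absurd hpl (not_isPlanar_of_embeds hS h.nodup hembeds)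

theorem isListed_of_checkExtensions (h : IsStarList G c leaves xs) (hconn : G.Connected)
    (hG : HasSmallLambda2 G) (htri : G.CliqueFree 3) (hpl : IsPlanar G) (hc : 0 < G.degree c)
    (hmax : ∀ v, G.degree v ≤ leaves.length) {n : ℕ} {av : List (List Bool)}
    (hav : AreAvailable G c leaves xs av)
    (hcheck : checkState leaves.length (checkExtensions leaves.length n)
      (outerCode G leaves xs) av) : IsListed G := by
  replace hcheck := h.of_checkState htri hpl hmax hcheck
  induction n generalizing xs av with
  | zero => exact absurd hcheck.2 Bool.false_ne_true
  | succ n ih =>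
    obtain ⟨⟨S, hS, hembeds⟩, hcheck⟩ := hcheck
    have extend {x : V} (hx : x ≠ c ∧ ¬ G.Adj c x) (hxs : x ∉ xs) {av' : List (List Bool)}
        (hav' : AreAvailable G c leaves xs av')
        (hcheck' : checkState leaves.length (checkExtensions leaves.length n)
          (outerCode G leaves (x :: xs)) av') : IsListed G :=
      ih (h.cons hx hxs) (fun y hy hys => hav' y hy fun hmem => hys (List.mem_cons_of_mem x hmem))
        ((h.cons hx hxs).of_checkState htri hpl hmax hcheck')
    cases av with
    | nil =>
      by_cases hcover : ∀ v, v ∈ leaves ++ (xs ++ [c])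
      · exact isListed_of_embeds hcover hS hembeds
      obtain ⟨x, hx, hxs, htrace, y, hy, hxy⟩ := h.exists_adj_of_empty_traces hconn hav hcover
      refine extend hx hxs hav ?_
      rw [outerCode, htrace]
      refine List.all_eq_true.1 hcheck _ (List.mem_filter.2 ⟨?_, ?_⟩)
      · exact htrace ▸ h.mem_extensions hG htri hc hx hxs
      · exact List.any_eq_true.2 ⟨true, List.mem_map.2 ⟨y, hy, decide_eq_true hxy⟩, rfl⟩
    | cons s av =>
      obtain ⟨hskip, hext⟩ := Bool.and_eq_true_iff.1 hcheck
      by_cases hs : ∃ x, (x ≠ c ∧ ¬ G.Adj c x) ∧ x ∉ xs ∧ trace G leaves x = s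
      · obtain ⟨x, hx, hxs, rfl⟩ := hs
        exact extend hx hxs hav (List.all_eq_true.1 hext _ (h.mem_extensions hG htri hc hx hxs))
      · refine ih h (fun x hx hxs => ?_) ⟨⟨S, hS, hembeds⟩, hskip⟩
        exact (hav x hx hxs).imp_left fun hmem =>
          (List.mem_cons.1 hmem).resolve_left fun e => hs ⟨x, hx, hxs, e⟩

end IsStarList

theorem isListed_of_checkDegree (hconn : G.Connected) (hG : HasSmallLambda2 G)
    (htri : G.CliqueFree 3) (hpl : IsPlanar G) (hc : 0 < G.degree c)
    (hmax : ∀ v, G.degree v ≤ G.degree c) (hcheck : checkDegree (G.degree c)) : IsListed G := by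
  classical
  obtain ⟨hempty, hfirst⟩ := Bool.and_eq_true_iff.1 hcheck
  let off := Finset.univ.filter fun x => (x ≠ c ∧ ¬ G.Adj c x) ∧ 0 < overlap G c x x
  obtain hoff | hoff := off.eq_empty_or_nonempty
  · obtain ⟨leaves, h⟩ := exists_isStarList_nil G c
    rw [← h.length_leaves] at hmax hempty
    refine h.isListed_of_checkExtensions hconn hG htri hpl hc hmax (fun x hx _ => .inr ?_) hempty
    refine h.trace_eq_replicate_false (Nat.eq_zero_of_not_pos fun hpos => ?_)
    exact Finset.filter_eq_empty_iff.1 hoff (Finset.mem_univ x) ⟨hx, hpos⟩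
  · obtain ⟨x, hxoff, hlargest⟩ := off.exists_max_image (fun x => overlap G c x x) hoff
    obtain ⟨-, hx, hpos⟩ := Finset.mem_filter.1 hxoff
    obtain ⟨leaves, h, htrace⟩ := exists_isStarList_singleton hx
    obtain ⟨k, hk⟩ := Nat.exists_eq_succ_of_ne_zero hpos.ne'
    rw [hk] at htrace
    rw [← h.length_leaves] at hmax hfirst
    have hsize := h.sizeOK_overlap hG htri hc hx
    have hle : overlap G c x x ≤ leaves.length := by
      rw [← h.commonLeaves_eq_overlap, commonLeaves_trace]
      exact List.countP_le_length
    have hcheck := List.all_eq_true.1 hfirst k (List.mem_range.2 (by omega))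
    rw [hk] at hsize
    rw [hsize, Bool.not_true, Bool.false_or, ← htrace] at hcheck
    refine h.isListed_of_checkExtensions hconn hG htri hpl hc hmax (fun y hy _ => ?_) hcheck
    obtain hy0 | hy0 := Nat.eq_zero_or_pos (overlap G c y y)
    · exact .inr (h.trace_eq_replicate_false hy0)
    · refine .inl (h.trace_mem_availableTraces hG htri hc hy hy0 (hk ▸ hlargest y ?_ :))
      exact Finset.mem_filter.2 ⟨Finset.mem_univ y, hy, hy0⟩

end SearchCorrectness

lemma checkDegree_of_le_five : ∀ d ≤ 5, 0 < d → checkDegree d := by decide +kernel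

section LargeDegree

variable {V : Type*} [Fintype V] {G : SimpleGraph V} [DecidableRel G.Adj] {c x y z a b : V}

lemma overlap_le_self (c x y : V) : overlap G c x y ≤ overlap G c x x :=
  Finset.card_le_card <| Finset.monotone_filter_right _ fun _ _ h => ⟨h.1, h.2.1, h.2.1⟩

lemma overlap_eq_zero_iff : overlap G c x y = 0 ↔ ∀ a, G.Adj c a → G.Adj x a → ¬ G.Adj y a := by
  simp [overlap, Finset.filter_eq_empty_iff]

lemma card_filter_not_adj_add_overlap (c x : V) :
    (Finset.univ.filter fun a => G.Adj c a ∧ ¬ G.Adj x a).card + overlap G c x x = G.degree c := by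
  have := Finset.card_filter_add_card_filter_not (s := G.neighborFinset c) fun a => G.Adj x a
  rw [SimpleGraph.card_neighborFinset_eq_degree, SimpleGraph.neighborFinset_eq_filter,
    Finset.filter_filter, Finset.filter_filter] at this
  simpa only [overlap, and_self, add_comm] using this

lemma degree_add_overlap_ge (c x y : V) :
    overlap G c x x + overlap G c y y ≤ G.degree c + overlap G c x y := by
  classical
  have hunion : (Finset.univ.filter fun a => G.Adj c a ∧ G.Adj x a ∧ G.Adj x a) ∪
      (Finset.univ.filter fun a => G.Adj c a ∧ G.Adj y a ∧ G.Adj y a) ⊆ G.neighborFinset c := by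
    intro a
    simp only [Finset.mem_union, Finset.mem_filter, SimpleGraph.mem_neighborFinset]
    rintro (h | h) <;> exact h.2.1
  have hinter : (Finset.univ.filter fun a => G.Adj c a ∧ G.Adj x a ∧ G.Adj x a) ∩
      (Finset.univ.filter fun a => G.Adj c a ∧ G.Adj y a ∧ G.Adj y a) =
      Finset.univ.filter fun a => G.Adj c a ∧ G.Adj x a ∧ G.Adj y a := by
    ext a
    simp only [Finset.mem_inter, Finset.mem_filter, Finset.mem_univ, true_and]
    tauto
  rw [overlap, overlap, overlap, ← Finset.card_union_add_card_inter, hinter]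
  exact Nat.add_le_add_right
    ((Finset.card_le_card hunion).trans_eq (G.card_neighborFinset_eq_degree c)) _

lemma IsPlanar.overlap_le_two (hpl : IsPlanar G) (hxc : x ≠ c) (hyc : y ≠ c) (hxy : x ≠ y) :
    overlap G c x y ≤ 2 := by
  by_contra! h
  obtain ⟨s, hs, hcard⟩ := Finset.exists_subset_card_eq h
  let r : Fin 3 → V := fun i => s.equivFin.symm (i.cast hcard.symm)
  have hr : Function.Injective r := Subtype.val_injective.comp
    (s.equivFin.symm.injective.comp (Fin.cast_injective _))
  refine hpl.false_of_three_common (l := ![c, x, y]) ?_ hr fun i j => ?_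
  · intro i j
    fin_cases i <;> fin_cases j <;> simp [hxc, hyc, hxy, hxc.symm, hyc.symm, hxy.symm]
  · have := hs (s.equivFin.symm (j.cast hcard.symm)).2
    simp only [Finset.mem_filter, Finset.mem_univ, true_and] at this
    fin_cases i
    exacts [this.1, this.2.1, this.2.2]

/-- A vertex outside the star of centre `c` that is adjacent to no leaf of the star. -/
structure IsDetached (G : SimpleGraph V) [DecidableRel G.Adj] (c x : V) : Prop where
  off_star : x ≠ c ∧ ¬ G.Adj c x
  overlap_eq : overlap G c x x = 0

/-- A vertex outside the star of centre `c` that is adjacent to exactly one leaf of the star. -/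
structure IsPendant (G : SimpleGraph V) [DecidableRel G.Adj] (c x : V) : Prop where
  off_star : x ≠ c ∧ ¬ G.Adj c x
  overlap_eq : overlap G c x x = 1

/-- A vertex outside the star of centre `c` that is adjacent to all leaves but at most two. -/
structure IsHub (G : SimpleGraph V) [DecidableRel G.Adj] (c x : V) : Prop where
  off_star : x ≠ c ∧ ¬ G.Adj c x
  degree_le : G.degree c ≤ overlap G c x x + 2

/-- The leaves of the star not adjacent to the hub, and the detached vertices. They stand for the
two indices of `F1` at which an edge is subdivided. -/
noncomputable def exceptional (G : SimpleGraph V) [DecidableRel G.Adj] (c : V) : Finset V := by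
  classical exact Finset.univ.filter fun v =>
    (∃ z, IsHub G c z ∧ G.Adj c v ∧ ¬ G.Adj z v) ∨ IsDetached G c v

lemma mem_exceptional : x ∈ exceptional G c ↔
    (∃ z, IsHub G c z ∧ G.Adj c x ∧ ¬ G.Adj z x) ∨ IsDetached G c x := by
  simp [exceptional]

lemma IsPendant.adj_leaf_iff (hx : IsPendant G c x) (hca : G.Adj c a) (hxa : G.Adj x a)
    (hcb : G.Adj c b) : G.Adj x b ↔ b = a := by
  obtain ⟨a', ha'⟩ := Finset.card_eq_one.1 hx.overlap_eq
  have hmem (b : V) (hcb : G.Adj c b) : G.Adj x b ↔ b = a' := by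
    rw [← Finset.mem_singleton, ← ha']
    simp [hcb]
  rw [hmem b hcb, ← (hmem a hca).1 hxa]

lemma IsPendant.exists_leaf (hx : IsPendant G c x) : ∃ a, G.Adj c a ∧ G.Adj x a := by
  by_contra! h
  exact one_ne_zero (hx.overlap_eq.symm.trans
    (overlap_eq_zero_iff.2 fun a hca hxa => absurd hxa (h a hca)))

lemma IsPendant.overlap_eq_zero_iff (hx : IsPendant G c x) (hca : G.Adj c a) (hxa : G.Adj x a) :
    overlap G c x y = 0 ↔ ¬ G.Adj y a := by
  rw [TriangleFreePlanar.overlap_eq_zero_iff]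
  refine ⟨fun h => h a hca hxa, fun h b hcb hxb => ?_⟩
  rwa [(hx.adj_leaf_iff hca hxa hcb).1 hxb]

variable (hG : HasSmallLambda2 G) (htri : G.CliqueFree 3) (hdeg : 6 ≤ G.degree c)
include hG htri hdeg

lemma isDetached_or_isPendant_or_isHub (hx : x ≠ c ∧ ¬ G.Adj c x) :
    IsDetached G c x ∨ IsPendant G c x ∨ IsHub G c x := by
  classical
  have h0 := hG.residualGram_self_nonneg htri (by omega) hx
  rw [residualGram_self] at h0
  by_contra! h
  have hk0 : overlap G c x x ≠ 0 := fun h0 => h.1 ⟨hx, h0⟩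
  have hk1 : overlap G c x x ≠ 1 := fun h1 => h.2.1 ⟨hx, h1⟩
  have hk2 : ¬ G.degree c ≤ overlap G c x x + 2 := fun h2 => h.2.2 ⟨hx, h2⟩
  have hlow : (2 : ℤ) ≤ overlap G c x x := by omega
  have hhigh : (overlap G c x x : ℤ) + 3 ≤ G.degree c := by omega
  have hdeg' : (6 : ℤ) ≤ G.degree c := by exact_mod_cast hdeg
  nlinarith [hdeg', mul_nonneg (sub_nonneg.2 hlow) (sub_nonneg.2 hhigh)]

lemma IsPendant.not_adj_and_overlap_eq_zero (hx : IsPendant G c x) (hy : IsPendant G c y)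
    (hne : x ≠ y) : ¬ G.Adj x y ∧ overlap G c x y = 0 := by
  classical
  have h := hG.residualGram_sq_le htri (by omega) hx.off_star hy.off_star
  have hdeg' : (6 : ℤ) ≤ G.degree c := by exact_mod_cast hdeg
  have hle := (overlap_le_self c x y).trans_eq hx.overlap_eq
  rw [residualGram_self, residualGram_self, hx.overlap_eq, hy.overlap_eq] at h
  by_cases hadj : G.Adj x y
  · rw [residualGram_of_adj htri hadj, hx.overlap_eq, hy.overlap_eq] at h
    push_cast at h
    nlinarith [hdeg']
  · refine ⟨hadj, ?_⟩
    rw [residualGram_of_not_adj hne hadj, hx.overlap_eq, hy.overlap_eq] at h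
    interval_cases overlap G c x y
    · rfl
    · push_cast at h
      nlinarith [hdeg']

lemma IsPendant.not_adj_of_isDetached (hx : IsPendant G c x) (hy : IsDetached G c y) :
    ¬ G.Adj x y := fun hadj => by
  classical
  have h := hG.residualGram_sq_le htri (by omega) hx.off_star hy.off_star
  have hdeg' : (6 : ℤ) ≤ G.degree c := by exact_mod_cast hdeg
  rw [residualGram_self, residualGram_self, residualGram_of_adj htri hadj, hx.overlap_eq,
    hy.overlap_eq] at h
  push_cast at h
  nlinarith [hdeg']

lemma IsHub.adj_pendant_iff (hz : IsHub G c z) (hx : IsPendant G c x) :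
    G.Adj z x ↔ overlap G c x z = 0 := by
  classical
  refine ⟨fun h => overlap_eq_zero_of_adj htri h.symm c, fun h0 => ?_⟩
  by_contra hadj
  have hne : x ≠ z := by
    rintro rfl
    have := hx.overlap_eq
    omega
  have h := hG.residualGram_sq_le htri (by omega) hx.off_star hz.off_star
  rw [residualGram_self, residualGram_self, residualGram_of_not_adj hne (fun h => hadj h.symm), h0,
    hx.overlap_eq] at h
  have hdeg' : (6 : ℤ) ≤ G.degree c := by exact_mod_cast hdeg
  have hle : (G.degree c : ℤ) ≤ overlap G c z z + 2 := by exact_mod_cast hz.degree_le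
  push_cast at h
  nlinarith [hdeg']

lemma IsHub.eq (hpl : IsPlanar G) (hz : IsHub G c z) (hy : IsHub G c y) : z = y := by
  classical
  by_contra hne
  have hle := hpl.overlap_le_two hz.off_star.1 hy.off_star.1 hne
  have hge := degree_add_overlap_ge (G := G) c z y
  have hz2 := hz.degree_le
  have hy2 := hy.degree_le
  have hdeg6 : G.degree c = 6 := by omega
  have hz4 : overlap G c z z = 4 := by omega
  have hy4 : overlap G c y y = 4 := by omega
  have hzy2 : overlap G c z y = 2 := by omega
  have hadj : ¬ G.Adj z y := fun hadj => by simp [overlap_eq_zero_of_adj htri hadj] at hzy2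
  have h := hG.residualGram_sq_le htri (by omega) hz.off_star hy.off_star
  rw [residualGram_self, residualGram_self, residualGram_of_not_adj hne hadj, hdeg6, hz4, hy4,
    hzy2] at h
  norm_num at h

lemma IsHub.degree_le_of_adj_isDetached (hz : IsHub G c z) (hy : IsDetached G c y)
    (hadj : G.Adj z y) : G.degree c ≤ overlap G c z z + 1 := by
  classical
  by_contra! hlt
  have heq : (overlap G c z z : ℤ) = G.degree c - 2 := by have := hz.degree_le; omega
  have h := hG.residualGram_sq_le htri (by omega) hz.off_star hy.off_star
  rw [residualGram_self, residualGram_self, residualGram_of_adj htri hadj, hy.overlap_eq, heq] at h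
  have hdeg' : (6 : ℤ) ≤ G.degree c := by exact_mod_cast hdeg
  push_cast at h
  nlinarith [hdeg']

lemma IsHub.not_adj_of_adj_isDetached (hz : IsHub G c z) (hx : IsDetached G c x)
    (hy : IsDetached G c y) (hzx : G.Adj z x) : ¬ G.Adj x y := fun hxy => by
  classical
  have hzy : z ≠ y := by
    rintro rfl
    have := hz.degree_le
    have := hy.overlap_eq
    omega
  have hnadj := not_adj_of_cliqueFree_three htri hzx.symm hxy
  have h := hG.residualGram_det_three_nonneg htri (by omega) hz.off_star hx.off_star hy.off_star
  have hoverlap : overlap G c z y = 0 := by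
    rw [overlap_comm]
    exact Nat.le_zero.1 ((overlap_le_self c y z).trans_eq hy.overlap_eq)
  rw [residualGram_of_adj htri hzx, residualGram_of_adj htri hxy,
    residualGram_of_not_adj hzy hnadj, residualGram_self c x, residualGram_self c y, hx.overlap_eq,
    hy.overlap_eq, hoverlap] at h
  have hdeg' : (6 : ℤ) ≤ G.degree c := by exact_mod_cast hdeg
  push_cast at h
  have : 0 < ((G.degree c : ℤ) - 1) ^ 3 := pow_pos (by linarith only [hdeg']) 3
  linarith

lemma IsDetached.exists_isHub_adj (hconn : G.Connected) (hy : IsDetached G c y) :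
    ∃ z, IsHub G c z ∧ G.Adj z y := by
  by_contra! hno
  obtain ⟨v, w, hv, hw, hvw⟩ := exists_adj_of_connected hconn (v := c) (w := y)
    (p := fun v => IsDetached G c v → ∃ z, IsHub G c z ∧ G.Adj z v)
    (fun h => absurd rfl h.off_star.1) fun h => (h hy).elim fun z hz => hno z hz.1 hz.2
  push Not at hw
  obtain ⟨hw, hno⟩ := hw
  have hvoff : v ≠ c ∧ ¬ G.Adj c v := by
    refine ⟨?_, fun hcv => ?_⟩
    · rintro rfl
      exact hw.off_star.2 hvw
    · exact overlap_eq_zero_iff.1 hw.overlap_eq v hcv hvw.symm hvw.symm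
  obtain hv' | hv' | hv' := isDetached_or_isPendant_or_isHub hG htri hdeg hvoff
  · obtain ⟨z, hz, hzv⟩ := hv hv'
    exact hz.not_adj_of_adj_isDetached hG htri hdeg hv' hw hzv hvw
  · exact hv'.not_adj_of_isDetached hG htri hdeg hw hvw
  · exact hno v hv' hvw

lemma IsHub.adj_isDetached (hconn : G.Connected) (hpl : IsPlanar G) (hz : IsHub G c z)
    (hy : IsDetached G c y) : G.Adj z y := by
  obtain ⟨z', hz', hadj⟩ := hy.exists_isHub_adj hG htri hdeg hconn
  rwa [hz.eq hG htri hdeg hpl hz']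

lemma IsHub.mem_exceptional_iff (hpl : IsPlanar G) (hz : IsHub G c z) (hca : G.Adj c a) :
    a ∈ exceptional G c ↔ ¬ G.Adj z a := by
  rw [mem_exceptional]
  refine ⟨?_, fun h => .inl ⟨z, hz, hca, h⟩⟩
  rintro (⟨z', hz', -, h⟩ | h)
  · rwa [hz.eq hG htri hdeg hpl hz']
  · exact absurd hca h.off_star.2

open Classical in
lemma IsHub.card_isDetached_add_overlap_le (hconn : G.Connected) (hpl : IsPlanar G)
    (hz : IsHub G c z) :
    (Finset.univ.filter fun y => IsDetached G c y).card + overlap G c z z ≤ G.degree z := by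
  rw [overlap, ← G.card_neighborFinset_eq_degree, ← Finset.card_union_of_disjoint]
  · refine Finset.card_le_card fun v hv => ?_
    rw [SimpleGraph.mem_neighborFinset]
    obtain hv | hv := Finset.mem_union.1 hv
    · exact hz.adj_isDetached hG htri hdeg hconn hpl (Finset.mem_filter.1 hv).2
    · exact (Finset.mem_filter.1 hv).2.2.1
  · exact Finset.disjoint_left.2 fun v hv hv' =>
      (Finset.mem_filter.1 hv).2.off_star.2 (Finset.mem_filter.1 hv').2.1

lemma card_exceptional_le_two (hconn : G.Connected) (hpl : IsPlanar G)
    (hmax : ∀ v, G.degree v ≤ G.degree c) : (exceptional G c).card ≤ 2 := by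
  classical
  obtain hempty | ⟨v, hv⟩ := (exceptional G c).eq_empty_or_nonempty
  · simp [hempty]
  obtain ⟨z, hz⟩ : ∃ z, IsHub G c z := (mem_exceptional.1 hv).elim
    (fun ⟨z, hz, _⟩ => ⟨z, hz⟩)
    fun hv => (hv.exists_isHub_adj hG htri hdeg hconn).imp fun _ h => h.1
  let missed := Finset.univ.filter fun a => G.Adj c a ∧ ¬ G.Adj z a
  let detached := Finset.univ.filter fun y => IsDetached G c y
  have hmissed : missed.card + overlap G c z z = G.degree c := card_filter_not_adj_add_overlap c z
  have hcard : (exceptional G c).card ≤ missed.card + detached.card := by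
    refine (Finset.card_le_card fun v hv => ?_).trans (Finset.card_union_le _ _)
    obtain ⟨z', hz', hv⟩ | hv := mem_exceptional.1 hv
    · rw [← hz.eq hG htri hdeg hpl hz'] at hv
      exact Finset.mem_union_left _ (Finset.mem_filter.2 ⟨Finset.mem_univ v, hv⟩)
    · exact Finset.mem_union_right _ (Finset.mem_filter.2 ⟨Finset.mem_univ v, hv⟩)
  have hdetached : detached.card + overlap G c z z ≤ G.degree c :=
    (hz.card_isDetached_add_overlap_le hG htri hdeg hconn hpl).trans (hmax z)
  obtain h0 | ⟨y, hy⟩ := detached.eq_empty_or_nonempty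
  · have := hz.degree_le
    rw [h0, Finset.card_empty] at hcard
    omega
  · have hy := (Finset.mem_filter.1 hy).2
    have := hz.degree_le_of_adj_isDetached hG htri hdeg hy
      (hz.adj_isDetached hG htri hdeg hconn hpl hy)
    omega

end LargeDegree

section Embedding

variable {V : Type*} [Fintype V] {G : SimpleGraph V} {c : V}

lemma exists_injective_lt_two_iff_mem (T : Finset V) (hT : T.card ≤ 2) :
    ∃ e : V → Fin (Fintype.card V + 2), Function.Injective e ∧ ∀ v, (e v).val < 2 ↔ v ∈ T := by
  classical
  have hlt (v : V) (h : v ∈ T) : (T.equivFin ⟨v, h⟩).val < 2 := (T.equivFin ⟨v, h⟩).2.trans_le hT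
  refine ⟨fun v => if h : v ∈ T then (T.equivFin ⟨v, h⟩).castLE (by omega)
    else (Fintype.equivFin V v).addNat 2, fun v w hvw => ?_, fun v => ?_⟩
  · replace hvw := congrArg Fin.val hvw
    by_cases hv : v ∈ T <;> by_cases hw : w ∈ T <;>
      simp only [hv, hw, ↓reduceDIte, Fin.val_castLE, Fin.val_addNat] at hvw
    · exact congrArg Subtype.val (T.equivFin.injective (Fin.ext hvw))
    · have := hlt v hv
      omega
    · have := hlt w hw
      omega
    · exact (Fintype.equivFin V).injective (Fin.ext (Nat.add_right_cancel hvw))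
  · by_cases hv : v ∈ T
    · simpa only [hv, ↓reduceDIte, Fin.val_castLE, iff_true] using hlt v hv
    · simp [hv]

/-- In terms of `F1 s`, the vertex `c` is `v1`, the hub is `v2`, and `foot v = foot w` means that
`v` and `w` have the same index. -/
lemma isIndContained_F1_of_foot {hub : V → Prop} {foot : V → V} {T : Finset V} (hT : T.card ≤ 2)
    (hub_unique : ∀ z z', hub z → hub z' → z = z') (hub_off_star : ∀ z, hub z → z ≠ c ∧ ¬ G.Adj c z)
    (hub_adj : ∀ z v, hub z → v ≠ c → ¬ hub v → (G.Adj z v ↔ (G.Adj c v ↔ foot v ∉ T)))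
    (adj_iff : ∀ v w, v ≠ c → ¬ hub v → w ≠ c → ¬ hub w →
      (G.Adj v w ↔ foot v = foot w ∧ ¬ (G.Adj c v ↔ G.Adj c w)))
    (eq_of_foot : ∀ v w, v ≠ c → ¬ hub v → w ≠ c → ¬ hub w → foot v = foot w →
      (G.Adj c v ↔ G.Adj c w) → v = w) :
    G.IsIndContained (F1 (Fintype.card V + 2)) := by
  classical
  obtain ⟨e, he, heT⟩ := exists_injective_lt_two_iff_mem T hT
  have heT' (v : V) : 2 ≤ (e v).val ↔ v ∉ T := by rw [← heT, not_lt]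
  let label (v : V) : F1Vertex (Fintype.card V + 2) :=
    if v = c then .v1 else if hub v then .v2
    else if G.Adj c v ↔ foot v ∉ T then .u (e (foot v)) else .w (e (foot v))
  have label_inj : Function.Injective label := fun v w h => by
    simp only [label] at h
    grind [he.eq_iff]
  have label_adj (v w : V) : (F1 _).Adj (label v) (label w) ↔ G.Adj v w := by
    simp only [F1_adj, label_inj.ne_iff]
    simp only [label]
    split_ifs <;> simp only [F1Edge, heT, heT', he.eq_iff] <;>
      grind [SimpleGraph.adj_comm, SimpleGraph.irrefl]
  exact ⟨⟨⟨label, label_inj⟩, fun {v w} => label_adj v w⟩⟩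

variable [DecidableRel G.Adj] {v w z : V}

/-- The leaf adjacent to a pendant vertex, and any other vertex itself. -/
noncomputable def foot (G : SimpleGraph V) [DecidableRel G.Adj] (c v : V) : V := by
  classical exact if h : IsPendant G c v then h.exists_leaf.choose else v

lemma IsPendant.adj_foot (hv : IsPendant G c v) : G.Adj c (foot G c v) ∧ G.Adj v (foot G c v) := by
  rw [foot, dif_pos hv]
  exact hv.exists_leaf.choose_spec

lemma foot_of_adj (hv : G.Adj c v) : foot G c v = v :=
  dif_neg fun h => h.off_star.2 hv

lemma IsDetached.foot_eq (hv : IsDetached G c v) : foot G c v = v :=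
  dif_neg fun h => zero_ne_one (hv.overlap_eq.symm.trans h.overlap_eq)

lemma IsPendant.adj_iff_eq_foot (hv : IsPendant G c v) (hw : G.Adj c w) :
    G.Adj v w ↔ w = foot G c v :=
  hv.adj_leaf_iff hv.adj_foot.1 hv.adj_foot.2 hw

lemma IsDetached.not_adj_of_adj (hv : IsDetached G c v) (hw : G.Adj c w) : ¬ G.Adj v w :=
  fun h => overlap_eq_zero_iff.1 hv.overlap_eq w hw h h

lemma IsDetached.ne_of_adj (hv : IsDetached G c v) (hw : G.Adj c w) : w ≠ v := by
  rintro rfl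
  exact hv.off_star.2 hw

variable (hG : HasSmallLambda2 G) (htri : G.CliqueFree 3) (hdeg : 6 ≤ G.degree c)
include hG htri hdeg

lemma adj_or_isDetached_or_isPendant (hv : v ≠ c) (hhub : ¬ IsHub G c v) :
    G.Adj c v ∨ IsDetached G c v ∨ IsPendant G c v := by
  by_cases hcv : G.Adj c v
  · exact .inl hcv
  · obtain h | h | h := isDetached_or_isPendant_or_isHub hG htri hdeg ⟨hv, hcv⟩
    exacts [.inr (.inl h), .inr (.inr h), absurd h hhub]

lemma IsHub.adj_iff_foot (hconn : G.Connected) (hpl : IsPlanar G) (hz : IsHub G c z) (hv : v ≠ c)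
    (hhub : ¬ IsHub G c v) :
    G.Adj z v ↔ (G.Adj c v ↔ foot G c v ∉ exceptional G c) := by
  obtain h | h | h := adj_or_isDetached_or_isPendant hG htri hdeg hv hhub
  · rw [foot_of_adj h, hz.mem_exceptional_iff hG htri hdeg hpl h, not_not, iff_true_left h]
  · rw [h.foot_eq, iff_true_left (hz.adj_isDetached hG htri hdeg hconn hpl h),
      iff_false_left h.off_star.2, not_not]
    exact mem_exceptional.2 (.inr h)
  · rw [hz.adj_pendant_iff hG htri hdeg h, h.overlap_eq_zero_iff h.adj_foot.1 h.adj_foot.2,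
      iff_false_left h.off_star.2, hz.mem_exceptional_iff hG htri hdeg hpl h.adj_foot.1, not_not]

lemma IsDetached.not_adj (hconn : G.Connected) (hv : IsDetached G c v) (hw : IsDetached G c w) :
    ¬ G.Adj v w := by
  obtain ⟨z, hz, hzv⟩ := hv.exists_isHub_adj hG htri hdeg hconn
  exact hz.not_adj_of_adj_isDetached hG htri hdeg hv hw hzv

lemma adj_iff_foot_eq_foot (hconn : G.Connected) (hv : v ≠ c) (hvhub : ¬ IsHub G c v) (hw : w ≠ c)
    (hwhub : ¬ IsHub G c w) :
    G.Adj v w ↔ foot G c v = foot G c w ∧ ¬ (G.Adj c v ↔ G.Adj c w) := by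
  obtain h | h | h := adj_or_isDetached_or_isPendant hG htri hdeg hv hvhub <;>
    obtain h' | h' | h' := adj_or_isDetached_or_isPendant hG htri hdeg hw hwhub
  · simp [h, h', not_adj_of_cliqueFree_three htri h h']
  · simp [foot_of_adj h, h'.foot_eq, G.adj_comm v w, h'.not_adj_of_adj h, h'.ne_of_adj h]
  · simp [h, h'.off_star.2, foot_of_adj h, G.adj_comm v w, h'.adj_iff_eq_foot h]
  · simp [foot_of_adj h', h.foot_eq, h.not_adj_of_adj h', (h.ne_of_adj h').symm]
  · simp [h.off_star.2, h'.off_star.2, h.not_adj hG htri hdeg hconn h']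
  · simp [h.off_star.2, h'.off_star.2, G.adj_comm v w, h'.not_adj_of_isDetached hG htri hdeg h]
  · simp [h', h.off_star.2, foot_of_adj h', h.adj_iff_eq_foot h', eq_comm]
  · simp [h.off_star.2, h'.off_star.2, h.not_adj_of_isDetached hG htri hdeg h']
  · obtain rfl | hne := eq_or_ne v w
    · simp
    · simp [h.off_star.2, h'.off_star.2, (h.not_adj_and_overlap_eq_zero hG htri hdeg h' hne).1]

lemma eq_of_foot_eq_foot (hv : v ≠ c) (hvhub : ¬ IsHub G c v) (hw : w ≠ c) (hwhub : ¬ IsHub G c w)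
    (hfoot : foot G c v = foot G c w) (hadj : G.Adj c v ↔ G.Adj c w) : v = w := by
  obtain h | h | h := adj_or_isDetached_or_isPendant hG htri hdeg hv hvhub <;>
    obtain h' | h' | h' := adj_or_isDetached_or_isPendant hG htri hdeg hw hwhub
  · rwa [foot_of_adj h, foot_of_adj h'] at hfoot
  · exact absurd (hadj.1 h) h'.off_star.2
  · exact absurd (hadj.1 h) h'.off_star.2
  · exact absurd (hadj.2 h') h.off_star.2
  · rwa [h.foot_eq, h'.foot_eq] at hfoot
  · rw [h.foot_eq] at hfoot
    exact absurd (hfoot ▸ h'.adj_foot.1) h.off_star.2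
  · exact absurd (hadj.2 h') h.off_star.2
  · rw [h'.foot_eq] at hfoot
    exact absurd (hfoot ▸ h.adj_foot.1) h'.off_star.2
  · by_contra hne
    have hoverlap := (h.not_adj_and_overlap_eq_zero hG htri hdeg h' hne).2
    rw [h.overlap_eq_zero_iff h.adj_foot.1 h.adj_foot.2, hfoot] at hoverlap
    exact hoverlap h'.adj_foot.2

theorem isIndContained_F1_of_six_le_degree (hconn : G.Connected) (hpl : IsPlanar G)
    (hmax : ∀ v, G.degree v ≤ G.degree c) : G.IsIndContained (F1 (Fintype.card V + 2)) :=
  isIndContained_F1_of_foot (card_exceptional_le_two hG htri hdeg hconn hpl hmax)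
    (fun _ _ hz hz' => hz.eq hG htri hdeg hpl hz') (fun _ hz => hz.off_star)
    (fun _ _ hz hv hhub => hz.adj_iff_foot hG htri hdeg hconn hpl hv hhub)
    (fun _ _ => adj_iff_foot_eq_foot hG htri hdeg hconn) fun _ _ => eq_of_foot_eq_foot hG htri hdeg

end Embedding

section Classification

variable {V : Type*} [Fintype V] {G : SimpleGraph V} [DecidableRel G.Adj]

theorem IsListed.hasSmallLambda2 (h : IsListed G) : HasSmallLambda2 G := by
  obtain ⟨_, -, ⟨f⟩⟩ | ⟨⟨f⟩⟩ | ⟨⟨f⟩⟩ | ⟨⟨f⟩⟩ | ⟨⟨f⟩⟩ | ⟨⟨f⟩⟩ | ⟨⟨f⟩⟩ | ⟨⟨f⟩⟩ | ⟨⟨f⟩⟩ | ⟨⟨f⟩⟩ |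
    ⟨⟨f⟩⟩ | ⟨⟨f⟩⟩ | ⟨⟨f⟩⟩ | ⟨⟨f⟩⟩ := h
  exacts [hasSmallLambda2_F1.of_embedding f, hasSmallLambda2_H1.of_embedding f,
    hasSmallLambda2_H2.of_embedding f, hasSmallLambda2_H3.of_embedding f,
    hasSmallLambda2_H4.of_embedding f, hasSmallLambda2_H5.of_embedding f,
    hasSmallLambda2_H6.of_embedding f, hasSmallLambda2_H7.of_embedding f,
    hasSmallLambda2_H8.of_embedding f, hasSmallLambda2_H9.of_embedding f,
    hasSmallLambda2_H10.of_embedding f, hasSmallLambda2_H11.of_embedding f,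
    hasSmallLambda2_H12.of_embedding f, hasSmallLambda2_H13.of_embedding f]

theorem HasSmallLambda2.isListed [Nontrivial V] (hG : HasSmallLambda2 G) (hconn : G.Connected)
    (htri : G.CliqueFree 3) (hpl : IsPlanar G) : IsListed G := by
  obtain ⟨c, hc⟩ := G.exists_maximal_degree_vertex
  have hmax (v : V) : G.degree v ≤ G.degree c := hc ▸ G.degree_le_maxDegree v
  obtain hdeg | hdeg := Nat.lt_or_ge (G.degree c) 6
  · have hpos : 0 < G.degree c := hconn.preconnected.degree_pos_of_nontrivial c
    exact isListed_of_checkDegree hconn hG htri hpl hpos hmax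
      (checkDegree_of_le_five _ (Nat.le_of_lt_succ hdeg) hpos)
  · have hcard : G.degree c < Fintype.card V := G.degree_lt_card_verts c
    exact .inl ⟨_, by omega, isIndContained_F1_of_six_le_degree hG htri hdeg hconn hpl hmax⟩

end Classification

end TriangleFreePlanar

theorem theorem3p1 {V : Type*} [Fintype V] [DecidableEq V] (G : SimpleGraph V)
    [DecidableRel G.Adj] (hV : 1 < Fintype.card V) (hconn : G.Connected)
    (htri : G.CliqueFree 3) (hplanar : TriangleFreePlanar.IsPlanar G) :
    TriangleFreePlanar.lambda2 G hV ≤ 1 ↔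
      (∃ s : ℕ, 3 ≤ s ∧ G.IsIndContained (TriangleFreePlanar.F1 s)) ∨
      G.IsIndContained TriangleFreePlanar.H1 ∨
      G.IsIndContained TriangleFreePlanar.H2 ∨
      G.IsIndContained TriangleFreePlanar.H3 ∨
      G.IsIndContained TriangleFreePlanar.H4 ∨
      G.IsIndContained TriangleFreePlanar.H5 ∨
      G.IsIndContained TriangleFreePlanar.H6 ∨
      G.IsIndContained TriangleFreePlanar.H7 ∨
      G.IsIndContained TriangleFreePlanar.H8 ∨
      G.IsIndContained TriangleFreePlanar.H9 ∨
      G.IsIndContained TriangleFreePlanar.H10 ∨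
      G.IsIndContained TriangleFreePlanar.H11 ∨
      G.IsIndContained TriangleFreePlanar.H12 ∨
      G.IsIndContained TriangleFreePlanar.H13 := by
  rw [TriangleFreePlanar.lambda2_le_one_iff]
  have := Fintype.one_lt_card_iff_nontrivial.1 hV
  exact ⟨fun hG => hG.isListed hconn htri hplanar, TriangleFreePlanar.IsListed.hasSmallLambda2⟩
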